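/- Let $k$ be a field. Let $\mathrm{BiAlg}$, $\mathrm{HopfAlg}$ and $\mathrm{SHopfAlg}$ be the categories of $k$-bialgebras, of Hopf $k$-algebras, and of Hopf $k$-algebras with bijective antipode (all with bialgebra maps as morphisms). **(a)** The inclusion $j:\mathrm{HopfAlg}\to\mathrm{BiAlg}$ has both a left adjoint $H^*$ and a right adjoint $H_*$. **(b)** The inclusion $i:\mathrm{SHopfAlg}\to\mathrm{HopfAlg}$ has both a left adjoint $K^*$ and a right adjoint $K_*$. The right adjoints can be described as follows. For a bialgebra $B$ put $B_n=B$ for even $n\ge 0$ and $B_n=B^{op,cop}$ (opposite multiplication and coopposite comultiplication) for odd $n$. The product $P$ of the $B_n$, $n\ge 0$, in $\mathrm{BiAlg}$ exists; let $\pi_n:P\to B_n$ be its projections, and let $S:P^{op,cop}\to P$ be the unique bialgebra map such that, for all $n\ge 0$, $\pi_n\circ S=\pi_{n+1}$ as maps $P^{op,cop}\to (B_{n+1})^{op,cop}=B_n$. Then the sum of all subcoalgebras $C\subseteq P$ such that $$c_{(1)}S(c_{(2)})=\varepsilon(c)1=S(c_{(1)})c_{(2)}\qquad\text{for all } c\in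 C$$ is itself a subcoalgebra of $P$ with this property, hence the largest one; with the bialgebra structure induced from $P$ it is a Hopf algebra with antipode $S$, and it is $H_*(B)$, the counit $H_*(B)\to B$ of the adjunction $(j,H_*)$ being the restriction of $\pi_0$. For every Hopf algebra $H$, the Hopf algebra $H_*(H^{op})$ has bijective antipode, and $$K_*(H)\cong\big(H_*(H^{op})\big)^{op},$$ where the counit $K_*(H)\to H$ of the adjunction $(i,K_*)$ corresponds to the counit $H_*(H^{op})\to H^{op}$ of the adjunction $(j,H_*)$. -/

import Mathlib

open CategoryTheory CategoryTheory.Limits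
open scoped TensorProduct

universe u

namespace HopfAdj

/-! ### Opposite and coopposite bialgebras -/

section Unbundled

variable (k : Type u) [Field k] (B : Type u) [Ring B] [Bialgebra k B]

/-- Applying `op` to both tensor factors reverses products. -/
lemma map_op_mul (x y : B ⊗[k] B) :
    TensorProduct.map (MulOpposite.opLinearEquiv k).toLinearMap
        (MulOpposite.opLinearEquiv k).toLinearMap (x * y) =
      TensorProduct.map (MulOpposite.opLinearEquiv k).toLinearMap
          (MulOpposite.opLinearEquiv k).toLinearMap y *
        TensorProduct.map (MulOpposite.opLinearEquiv k).toLinearMap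
          (MulOpposite.opLinearEquiv k).toLinearMap x := by
  induction x with
  | zero => simp
  | add x₁ x₂ h₁ h₂ => simp [add_mul, mul_add, h₁, h₂]
  | tmul a b =>
    induction y with
    | zero => simp
    | add y₁ y₂ h₁ h₂ => simp [add_mul, mul_add, h₁, h₂]
    | tmul c d => simp

/-- `B^{op}`: the opposite multiplication and the comultiplication of `B`
(the coalgebra structure on `Bᵐᵒᵖ` is Mathlib's). -/
noncomputable abbrev opBialgebra : Bialgebra k Bᵐᵒᵖ :=
  Bialgebra.mk' k Bᵐᵒᵖ
    (by simp [MulOpposite.counit_def])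
    (by intro a b; simp [MulOpposite.counit_def, mul_comm])
    (by simp [MulOpposite.comul_def, Algebra.TensorProduct.one_def])
    (by intro a b; simp [MulOpposite.comul_def, map_op_mul])

/-- The coopposite coalgebra: `c ↦ c₍₂₎ ⊗ c₍₁₎`. -/
noncomputable abbrev copCoalgebra : Coalgebra k B where
  comul := (TensorProduct.comm k B B).toLinearMap ∘ₗ Coalgebra.comul
  counit := Coalgebra.counit
  coassoc := by
    have key₁ (x : B ⊗[k] B) :
        TensorProduct.assoc k B B B (LinearMap.rTensor B
          ((TensorProduct.comm k B B).toLinearMap ∘ₗ Coalgebra.comul) (TensorProduct.comm k B B x)) =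
        TensorProduct.assoc k B B B (TensorProduct.comm k _ _
          (LinearMap.lTensor B (TensorProduct.comm k B B).toLinearMap
            (LinearMap.lTensor B Coalgebra.comul x))) := by
      induction x with
      | zero => simp
      | add x y hx hy => simp only [map_add, hx, hy]
      | tmul a b => simp
    have key₂ (z : B ⊗[k] B) (b : B) :
        b ⊗ₜ[k] TensorProduct.comm k B B z =
        TensorProduct.assoc k B B B (TensorProduct.comm k _ _
          (LinearMap.lTensor B (TensorProduct.comm k B B).toLinearMap
            (TensorProduct.assoc k B B B (z ⊗ₜ[k] b)))) := by
      induction z with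
      | zero => simp
      | add x y hx hy => simp only [map_add, TensorProduct.add_tmul, TensorProduct.tmul_add, hx, hy]
      | tmul a c => simp
    have key₃ (x : B ⊗[k] B) :
        LinearMap.lTensor B ((TensorProduct.comm k B B).toLinearMap ∘ₗ Coalgebra.comul)
          (TensorProduct.comm k B B x) =
        TensorProduct.assoc k B B B (TensorProduct.comm k _ _
          (LinearMap.lTensor B (TensorProduct.comm k B B).toLinearMap
            (TensorProduct.assoc k B B B (LinearMap.rTensor B Coalgebra.comul x)))) := by
      induction x with
      | zero => simp
      | add x y hx hy => simp only [map_add, hx, hy]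
      | tmul a b => simpa using key₂ (Coalgebra.comul a) b
    ext b
    simp only [LinearMap.comp_apply, LinearEquiv.coe_coe]
    rw [key₁, key₃, Coalgebra.coassoc_apply]
  rTensor_counit_comp_comul := by
    have key (x : B ⊗[k] B) :
        LinearMap.rTensor B (Coalgebra.counit (R := k)) (TensorProduct.comm k B B x) =
          TensorProduct.comm k B k (LinearMap.lTensor B Coalgebra.counit x) := by
      induction x with
      | zero => simp
      | add x y hx hy => simp only [map_add, hx, hy]
      | tmul a b => simp
    ext b
    simp [key]
  lTensor_counit_comp_comul := by
    have key (x : B ⊗[k] B) :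
        LinearMap.lTensor B (Coalgebra.counit (R := k)) (TensorProduct.comm k B B x) =
          TensorProduct.comm k k B (LinearMap.rTensor B Coalgebra.counit x) := by
      induction x with
      | zero => simp
      | add x y hx hy => simp only [map_add, hx, hy]
      | tmul a b => simp
    ext b
    simp [key]

/-- `B^{cop}`: the multiplication of `B` and the coopposite comultiplication. -/
noncomputable abbrev copBialgebra : Bialgebra k B :=
  Bialgebra.mk' (C := copCoalgebra k B) k B
    (Bialgebra.counit_one (R := k) (A := B))
    (fun {a b} => Bialgebra.counit_mul (R := k) a b)
    (by
      change TensorProduct.comm k B B (Coalgebra.comul (1 : B)) = 1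
      simp [Algebra.TensorProduct.one_def])
    (by
      intro a b
      change TensorProduct.comm k B B (Coalgebra.comul (a * b)) =
        TensorProduct.comm k B B (Coalgebra.comul a) * TensorProduct.comm k B B (Coalgebra.comul b)
      rw [Bialgebra.comul_mul]
      exact map_mul (Algebra.TensorProduct.comm k B B) _ _)

/-- `B^{op,cop}`, on the carrier `Bᵐᵒᵖ`. -/
noncomputable abbrev opCopBialgebra : Bialgebra k Bᵐᵒᵖ :=
  letI : Bialgebra k Bᵐᵒᵖ := opBialgebra k B
  copBialgebra k Bᵐᵒᵖ

end Unbundled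

section HopfOp

variable (k : Type u) [Field k] (H : Type u) [Ring H] [HopfAlgebra k H]

/-- The inverse of a bijective antipode. -/
noncomputable def antipodeInv
    (h : Function.Bijective (HopfAlgebra.antipode k : H →ₗ[k] H)) : H →ₗ[k] H :=
  (LinearEquiv.ofBijective (HopfAlgebra.antipode k) h).symm.toLinearMap

lemma antipode_antipodeInv
    (h : Function.Bijective (HopfAlgebra.antipode k : H →ₗ[k] H)) (x : H) :
    HopfAlgebra.antipode k (antipodeInv k H h x) = x :=
  (LinearEquiv.ofBijective (HopfAlgebra.antipode k) h).apply_symm_apply x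

/-- If the antipode `S` of `H` is bijective, then `H^{op}` is a Hopf algebra with antipode
`S⁻¹`. -/
noncomputable abbrev opHopfAlgebra
    (h : Function.Bijective (HopfAlgebra.antipode k : H →ₗ[k] H)) : HopfAlgebra k Hᵐᵒᵖ :=
  letI : Bialgebra k Hᵐᵒᵖ := opBialgebra k H
  { antipode := (MulOpposite.opLinearEquiv k).toLinearMap ∘ₗ antipodeInv k H h ∘ₗ
      (MulOpposite.opLinearEquiv k).symm.toLinearMap
    mul_antipode_rTensor_comul := by
      have key (x : H ⊗[k] H) : HopfAlgebra.antipode k (MulOpposite.unop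
          (LinearMap.mul' k Hᵐᵒᵖ (LinearMap.rTensor Hᵐᵒᵖ
            ((MulOpposite.opLinearEquiv k).toLinearMap ∘ₗ antipodeInv k H h ∘ₗ
              (MulOpposite.opLinearEquiv k).symm.toLinearMap)
            (TensorProduct.map (MulOpposite.opLinearEquiv k).toLinearMap
              (MulOpposite.opLinearEquiv k).toLinearMap x)))) =
          LinearMap.mul' k H (LinearMap.lTensor H (HopfAlgebra.antipode k) x) := by
        induction x with
        | zero => simp
        | add x y hx hy => simp only [map_add, MulOpposite.unop_add, hx, hy]
        | tmul a b => simp [HopfAlgebra.antipode_mul_antidistrib, antipode_antipodeInv]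
      ext a
      apply MulOpposite.unop_injective
      apply h.1
      refine (key _).trans ?_
      refine (HopfAlgebra.mul_antipode_lTensor_comul_apply (R := k) _).trans ?_
      simp [MulOpposite.counit_def, Algebra.algebraMap_eq_smul_one]
    mul_antipode_lTensor_comul := by
      have key (x : H ⊗[k] H) : HopfAlgebra.antipode k (MulOpposite.unop
          (LinearMap.mul' k Hᵐᵒᵖ (LinearMap.lTensor Hᵐᵒᵖ
            ((MulOpposite.opLinearEquiv k).toLinearMap ∘ₗ antipodeInv k H h ∘ₗ
              (MulOpposite.opLinearEquiv k).symm.toLinearMap)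
            (TensorProduct.map (MulOpposite.opLinearEquiv k).toLinearMap
              (MulOpposite.opLinearEquiv k).toLinearMap x)))) =
          LinearMap.mul' k H (LinearMap.rTensor H (HopfAlgebra.antipode k) x) := by
        induction x with
        | zero => simp
        | add x y hx hy => simp only [map_add, MulOpposite.unop_add, hx, hy]
        | tmul a b => simp [HopfAlgebra.antipode_mul_antidistrib, antipode_antipodeInv]
      ext a
      apply MulOpposite.unop_injective
      apply h.1
      refine (key _).trans ?_
      refine (HopfAlgebra.mul_antipode_rTensor_comul_apply (R := k) _).trans ?_
      simp [MulOpposite.counit_def, Algebra.algebraMap_eq_smul_one] }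

end HopfOp

/-! ### The categories and the inclusions -/

section Categories

variable (k : Type u) [Field k]

/-- The inclusion of Hopf algebras into bialgebras. -/
abbrev hopfToBialg : HopfAlgCat.{u} k ⥤ BialgCat.{u} k :=
  forget₂ (HopfAlgCat.{u} k) (BialgCat.{u} k)

/-- Hopf algebras with bijective antipode. -/
def bijectiveAntipode : ObjectProperty (HopfAlgCat.{u} k) :=
  fun H => Function.Bijective (HopfAlgebra.antipode k : H →ₗ[k] H)

/-- The category of Hopf algebras with bijective antipode. -/
abbrev SHopfAlgCat := (bijectiveAntipode k).FullSubcategory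

/-- The inclusion of Hopf algebras with bijective antipode into all Hopf algebras. -/
abbrev shopfToHopf : SHopfAlgCat k ⥤ HopfAlgCat.{u} k := (bijectiveAntipode k).ι

variable {k}

/-- The bialgebra `B^{op}`. -/
noncomputable def opBialg (B : BialgCat.{u} k) : BialgCat.{u} k :=
  letI : Bialgebra k (B : Type u)ᵐᵒᵖ := opBialgebra k B
  BialgCat.of k (B : Type u)ᵐᵒᵖ

/-- The bialgebra `H^{op}`, for an arbitrary Hopf algebra `H`. -/
noncomputable abbrev hopfOpBialg (H : HopfAlgCat.{u} k) : BialgCat.{u} k :=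
  opBialg ((hopfToBialg k).obj H)

/-- The bialgebra `B^{op,cop}`. -/
noncomputable def opCop (B : BialgCat.{u} k) : BialgCat.{u} k :=
  letI : Bialgebra k (B : Type u)ᵐᵒᵖ := opCopBialgebra k B
  BialgCat.of k (B : Type u)ᵐᵒᵖ

/-- The Hopf algebra `H^{op}`, for `H` with bijective antipode. -/
noncomputable def opHopf (H : HopfAlgCat.{u} k)
    (h : Function.Bijective (HopfAlgebra.antipode k : H →ₗ[k] H)) : HopfAlgCat.{u} k :=
  letI : HopfAlgebra k (H : Type u)ᵐᵒᵖ := opHopfAlgebra k H h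
  HopfAlgCat.of k (H : Type u)ᵐᵒᵖ

/-- The identity map `B → B^{op}`, as a linear isomorphism. -/
def opBialgEquiv (B : BialgCat.{u} k) : B ≃ₗ[k] opBialg B :=
  MulOpposite.opLinearEquiv k

/-- The identity map `B → B^{op,cop}`, as a linear isomorphism. -/
def opCopEquiv (B : BialgCat.{u} k) : B ≃ₗ[k] opCop B :=
  MulOpposite.opLinearEquiv k

/-- The identity map `H → H^{op}`, as a linear isomorphism. -/
def opHopfEquiv (H : HopfAlgCat.{u} k)
    (h : Function.Bijective (HopfAlgebra.antipode k : H →ₗ[k] H)) : H ≃ₗ[k] opHopf H h :=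
  MulOpposite.opLinearEquiv k

lemma opCop_comul (B : BialgCat.{u} k) (b : B) :
    Coalgebra.comul (R := k) (opCopEquiv B b) =
      TensorProduct.comm k _ _ (TensorProduct.map (opCopEquiv B).toLinearMap
        (opCopEquiv B).toLinearMap (Coalgebra.comul (R := k) b)) := rfl

/-- A bialgebra map `f : B → B'`, regarded as a map `B^{op,cop} → B'^{op,cop}`. -/
noncomputable def opCopMap {B B' : BialgCat.{u} k} (f : B ⟶ B') : opCop B ⟶ opCop B' :=
  ⟨BialgHom.ofAlgHom (A := opCop B) (B := opCop B')
    (AlgHom.ofLinearMap ((opCopEquiv B').toLinearMap ∘ₗ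
        (f.toBialgHom : B →ₗ[k] B') ∘ₗ (opCopEquiv B).symm.toLinearMap)
      (congrArg MulOpposite.op (map_one f.toBialgHom))
      (fun a b => congrArg MulOpposite.op (map_mul f.toBialgHom b.unop a.unop)))
    (by
      ext x
      obtain ⟨b, rfl⟩ := (opCopEquiv B).surjective x
      have h := CoalgHomClass.counit_comp_apply f.toBialgHom b
      exact h)
    (by
      have key (x : B ⊗[k] B) :
          TensorProduct.map ((opCopEquiv B').toLinearMap ∘ₗ
              (f.toBialgHom : B →ₗ[k] B') ∘ₗ (opCopEquiv B).symm.toLinearMap)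
            ((opCopEquiv B').toLinearMap ∘ₗ
              (f.toBialgHom : B →ₗ[k] B') ∘ₗ (opCopEquiv B).symm.toLinearMap)
            (TensorProduct.comm k _ _ (TensorProduct.map (opCopEquiv B).toLinearMap
              (opCopEquiv B).toLinearMap x)) =
          TensorProduct.comm k _ _ (TensorProduct.map (opCopEquiv B').toLinearMap
              (opCopEquiv B').toLinearMap
            (TensorProduct.map (f.toBialgHom : B →ₗ[k] B') (f.toBialgHom : B →ₗ[k] B') x)) := by
        induction x with
        | zero => simp
        | add x y hx hy => simp only [map_add, hx, hy]
        | tmul a b => simp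
      ext x
      obtain ⟨b, rfl⟩ := (opCopEquiv B).surjective x
      refine (key (Coalgebra.comul (R := k) b)).trans ?_
      have h := CoalgHomClass.map_comp_comul_apply f.toBialgHom b
      refine (congrArg _ (congrArg _ h)).trans ?_
      exact (opCop_comul B' _).symm)⟩

/-- The identity map `(B^{op,cop})^{op,cop} → B`. -/
noncomputable def opCopOpCop (B : BialgCat.{u} k) : opCop (opCop B) ⟶ B :=
  ⟨BialgHom.ofAlgHom (A := opCop (opCop B)) (B := B)
    (AlgHom.ofLinearMap
      ((opCopEquiv B).symm.toLinearMap ∘ₗ (opCopEquiv (opCop B)).symm.toLinearMap)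
      rfl (fun _ _ => rfl))
    (by
      ext x
      obtain ⟨y, rfl⟩ := (opCopEquiv (opCop B)).surjective x
      obtain ⟨b, rfl⟩ := (opCopEquiv B).surjective y
      rfl)
    (by
      have key (x : B ⊗[k] B) :
          TensorProduct.map
            ((opCopEquiv B).symm.toLinearMap ∘ₗ (opCopEquiv (opCop B)).symm.toLinearMap)
            ((opCopEquiv B).symm.toLinearMap ∘ₗ (opCopEquiv (opCop B)).symm.toLinearMap)
            (TensorProduct.comm k _ _ (TensorProduct.map (opCopEquiv (opCop B)).toLinearMap
              (opCopEquiv (opCop B)).toLinearMap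
              (TensorProduct.comm k _ _ (TensorProduct.map (opCopEquiv B).toLinearMap
                (opCopEquiv B).toLinearMap x)))) = x := by
        induction x with
        | zero => simp
        | add x y hx hy => simp only [map_add, hx, hy]
        | tmul a b => simp
      ext x
      obtain ⟨y, rfl⟩ := (opCopEquiv (opCop B)).surjective x
      obtain ⟨b, rfl⟩ := (opCopEquiv B).surjective y
      exact key (Coalgebra.comul (R := k) b))⟩

/-! ### The product of alternating copies, the shift, and the largest subcoalgebra on which
the shift acts as an antipode -/

/-- The sequence `B, B^{op,cop}, B, B^{op,cop}, …`. -/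
noncomputable def alternating (B : BialgCat.{u} k) : ℕ → BialgCat.{u} k
  | 0 => B
  | 1 => opCop B
  | n + 2 => alternating B n

/-- The identity map `(B_{n+1})^{op,cop} → B_n`, as a bialgebra map. -/
noncomputable def alternatingId (B : BialgCat.{u} k) :
    (n : ℕ) → (opCop (alternating B (n + 1)) ⟶ alternating B n)
  | 0 => opCopOpCop B
  | 1 => 𝟙 (opCop B)
  | n + 2 => alternatingId B n

variable {B : BialgCat.{u} k} {c : Fan (alternating B)}

/-- The unique bialgebra map `S : P^{op,cop} → P`, for a product `P` of the `B_n` with projections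
`π_n`, such that `π_n ∘ S` is `π_{n+1} : P^{op,cop} → (B_{n+1})^{op,cop} = B_n` for all `n`. -/
noncomputable def shift (hc : IsLimit c) : opCop c.pt ⟶ c.pt :=
  Fan.IsLimit.lift hc fun n => opCopMap (c.proj (n + 1)) ≫ alternatingId B n

/-- The shift as a linear endomorphism of `P`. -/
noncomputable def shiftLin (hc : IsLimit c) : c.pt →ₗ[k] c.pt :=
  ((shift hc).toBialgHom : opCop c.pt →ₗ[k] c.pt) ∘ₗ (opCopEquiv c.pt).toLinearMap

/-- `C ⊆ P` is a subcoalgebra: `Δ(C) ⊆ C ⊗ C`. -/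
def IsSubcoalgebra (P : Type u) [Ring P] [Bialgebra k P] (C : Submodule k P) : Prop :=
  ∀ x ∈ C, Coalgebra.comul (R := k) x ∈ LinearMap.range (TensorProduct.map C.subtype C.subtype)

/-- `c₍₁₎ S(c₍₂₎) = ε(c) 1 = S(c₍₁₎) c₍₂₎` for all `c ∈ C`. -/
def ActsAsAntipode (P : Type u) [Ring P] [Bialgebra k P] (S : P →ₗ[k] P)
    (C : Submodule k P) : Prop :=
  ∀ x ∈ C,
    LinearMap.mul' k P (S.lTensor P (Coalgebra.comul (R := k) x)) =
        algebraMap k P (Coalgebra.counit (R := k) x) ∧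
      LinearMap.mul' k P (S.rTensor P (Coalgebra.comul (R := k) x)) =
        algebraMap k P (Coalgebra.counit (R := k) x)

/-- The subcoalgebras of `P` on which the shift acts as an antipode. -/
def antipodalSubcoalgebras (hc : IsLimit c) : Set (Submodule k c.pt) :=
  {C | IsSubcoalgebra c.pt C ∧ ActsAsAntipode c.pt (shiftLin hc) C}

/-- The sum of all subcoalgebras of `P` on which the shift acts as an antipode. -/
noncomputable def antipodalPart (hc : IsLimit c) : Submodule k c.pt :=
  sSup (antipodalSubcoalgebras hc)

end Categories

end HopfAdj

/-! Right adjoint of `j`. The antipode of a Hopf algebra `X` reverses products and coproducts, so a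
bialgebra map `f : X → B` yields bialgebra maps `f ∘ S^n : X → B_n` and hence one map `F : X → P`.
Comparing components gives `shift ∘ F = F ∘ S`. The image of `F` is therefore a subcoalgebra on
which the shift acts as an antipode, and `F` lands in the largest one. That subcoalgebra contains
`1` and is closed under products and the shift, because the shift is antimultiplicative and
anticomultiplicative; so it is a Hopf algebra. Bialgebra maps between Hopf algebras commute with
antipodes, so `π_0 ∘ F` determines every component of `F`, which gives uniqueness
(`CofreeHopf.exists_lift`, `CofreeHopf.hom_ext`).

Left adjoint of `j`. Dually, `FreeHopf B` is the algebra generated by all the `B_n`, with relations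
making each inclusion multiplicative and consecutive inclusions convolution inverse to each other.
Its antipode moves `B_n` to `B_{n+1}`.

Products. Every element of a coalgebra lies in a countably spanned subcoalgebra, so coalgebras of
countable dimension suffice to test maps, and up to isomorphism they live on subspaces of one fixed
space. The direct sum of all cones of this kind, modulo the largest coideal killed by all
projections, is the product of coalgebras. The multiplications of the factors induce one on the
product, and its axioms follow from uniqueness of coalgebra maps into the product
(`hasProduct_bialgCat`).

Part (b). Let `Q` be cofree on `H^{op}`, and read its counit as an antimultiplicative map `q' : Q →
H`. Uniqueness of inverses gives `s ∘ q' ∘ S = q'`, with `s` and `S` the antipodes of `H` and `Q`.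
The map `s ∘ q'` is a bialgebra map `Q^{op,cop} → H^{op}`, and its lift to `Q` is the inverse of `S`
(`bijective_antipode_of_cofree`). For `X` with bijective antipode, `X^{op}` is a Hopf algebra, and
maps `X → Q^{op}`, `X^{op} → Q`, `X^{op} → H^{op}`, `X → H` all correspond. The left adjoint of `i`
comes from `FreeHopf` of `H^{op}` in the same way. -/

namespace HopfAdj

/-! ### Linear maps preserving or reversing products and coproducts, and convolution inverses. -/

section Predicates

variable {k : Type*} [CommRing k]

/-- The linear map `f` is multiplicative and unital. -/
structure IsMulHom {A B : Type*} [Ring A] [Algebra k A] [Ring B] [Algebra k B]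
    (f : A →ₗ[k] B) : Prop where
  map_one : f 1 = 1
  map_mul : ∀ x y, f (x * y) = f x * f y

/-- The linear map `f` is antimultiplicative and unital. -/
structure IsAntiMulHom {A B : Type*} [Ring A] [Algebra k A] [Ring B] [Algebra k B]
    (f : A →ₗ[k] B) : Prop where
  map_one : f 1 = 1
  map_mul : ∀ x y, f (x * y) = f y * f x

/-- The linear map `f` is comultiplicative and counital. -/
structure IsComulHom {C D : Type*} [AddCommGroup C] [Module k C] [Coalgebra k C]
    [AddCommGroup D] [Module k D] [Coalgebra k D] (f : C →ₗ[k] D) : Prop where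
  counit : ∀ x, Coalgebra.counit (R := k) (f x) = Coalgebra.counit (R := k) x
  comul : ∀ x, Coalgebra.comul (R := k) (f x) =
    TensorProduct.map f f (Coalgebra.comul (R := k) x)

/-- The linear map `f` is anticomultiplicative and counital. -/
structure IsAntiComulHom {C D : Type*} [AddCommGroup C] [Module k C] [Coalgebra k C]
    [AddCommGroup D] [Module k D] [Coalgebra k D] (f : C →ₗ[k] D) : Prop where
  counit : ∀ x, Coalgebra.counit (R := k) (f x) = Coalgebra.counit (R := k) x
  comul : ∀ x, Coalgebra.comul (R := k) (f x) =
    TensorProduct.comm k D D (TensorProduct.map f f (Coalgebra.comul (R := k) x))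

section Mul

variable {A B C : Type*} [Ring A] [Algebra k A] [Ring B] [Algebra k B] [Ring C] [Algebra k C]

lemma isMulHom_algHom (f : A →ₐ[k] B) : IsMulHom f.toLinearMap :=
  ⟨map_one f, map_mul f⟩

/-- A multiplicative linear map as an algebra map. -/
def IsMulHom.toAlgHom {f : A →ₗ[k] B} (hf : IsMulHom f) : A →ₐ[k] B :=
  AlgHom.ofLinearMap f hf.map_one hf.map_mul

lemma IsAntiMulHom.comp_anti {g : B →ₗ[k] C} {f : A →ₗ[k] B} (hg : IsAntiMulHom g)
    (hf : IsAntiMulHom f) : IsMulHom (g ∘ₗ f) :=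
  ⟨by simp [hf.map_one, hg.map_one], fun x y => by simp [hf.map_mul, hg.map_mul]⟩

lemma IsAntiMulHom.comp {g : B →ₗ[k] C} {f : A →ₗ[k] B} (hg : IsAntiMulHom g)
    (hf : IsMulHom f) : IsAntiMulHom (g ∘ₗ f) :=
  ⟨by simp [hf.map_one, hg.map_one], fun x y => by simp [hf.map_mul, hg.map_mul]⟩

lemma IsMulHom.comp_anti {g : B →ₗ[k] C} {f : A →ₗ[k] B} (hg : IsMulHom g)
    (hf : IsAntiMulHom f) : IsAntiMulHom (g ∘ₗ f) :=
  ⟨by simp [hf.map_one, hg.map_one], fun x y => by simp [hf.map_mul, hg.map_mul]⟩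

lemma IsAntiMulHom.symm {f : A ≃ₗ[k] B} (hf : IsAntiMulHom f.toLinearMap) :
    IsAntiMulHom f.symm.toLinearMap := by
  constructor
  · apply f.injective
    simpa using hf.map_one.symm
  · intro x y
    apply f.injective
    simpa using (hf.map_mul (f.symm y) (f.symm x)).symm

lemma isAntiMulHom_op : IsAntiMulHom (MulOpposite.opLinearEquiv k (M := A)).toLinearMap :=
  ⟨rfl, fun _ _ => rfl⟩

lemma isAntiMulHom_unop : IsAntiMulHom (MulOpposite.opLinearEquiv k (M := A)).symm.toLinearMap :=
  ⟨rfl, fun _ _ => rfl⟩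

end Mul

section Comul

variable {C D E : Type*} [AddCommGroup C] [Module k C] [Coalgebra k C]
  [AddCommGroup D] [Module k D] [Coalgebra k D] [AddCommGroup E] [Module k E] [Coalgebra k E]

lemma isComulHom_coalgHom (f : C →ₗc[k] D) : IsComulHom f.toLinearMap :=
  ⟨fun x => CoalgHomClass.counit_comp_apply f x,
    fun x => (CoalgHomClass.map_comp_comul_apply f x).symm⟩

/-- A comultiplicative linear map as a coalgebra map. -/
def IsComulHom.toCoalgHom {f : C →ₗ[k] D} (hf : IsComulHom f) : C →ₗc[k] D where
  toLinearMap := f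
  counit_comp := LinearMap.ext hf.counit
  map_comp_comul := LinearMap.ext fun x => (hf.comul x).symm

lemma map_comp_apply {M N P M' N' P' : Type*} [AddCommGroup M] [AddCommGroup N] [AddCommGroup P]
    [AddCommGroup M'] [AddCommGroup N'] [AddCommGroup P'] [Module k M] [Module k N] [Module k P]
    [Module k M'] [Module k N'] [Module k P'] (g : N →ₗ[k] P) (f : M →ₗ[k] N)
    (g' : N' →ₗ[k] P') (f' : M' →ₗ[k] N') (x : M ⊗[k] M') :
    TensorProduct.map (g ∘ₗ f) (g' ∘ₗ f') x =
      TensorProduct.map g g' (TensorProduct.map f f' x) := by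
  rw [TensorProduct.map_comp]; rfl

lemma comm_comm_apply {M N : Type*} [AddCommGroup M] [AddCommGroup N] [Module k M] [Module k N]
    (x : M ⊗[k] N) : TensorProduct.comm k N M (TensorProduct.comm k M N x) = x :=
  (TensorProduct.comm k M N).symm_apply_apply x

lemma IsComulHom.comp {g : D →ₗ[k] E} {f : C →ₗ[k] D} (hg : IsComulHom g)
    (hf : IsComulHom f) : IsComulHom (g ∘ₗ f) :=
  ⟨by simp [hf.counit, hg.counit], fun x => by
    simp only [LinearMap.comp_apply, hf.comul, hg.comul, map_comp_apply]⟩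

lemma IsAntiComulHom.comp_anti {g : D →ₗ[k] E} {f : C →ₗ[k] D} (hg : IsAntiComulHom g)
    (hf : IsAntiComulHom f) : IsComulHom (g ∘ₗ f) :=
  ⟨by simp [hf.counit, hg.counit], fun x => by
    simp only [LinearMap.comp_apply, hf.comul, hg.comul, map_comp_apply, TensorProduct.map_comm,
      comm_comm_apply]⟩

lemma IsAntiComulHom.comp {g : D →ₗ[k] E} {f : C →ₗ[k] D} (hg : IsAntiComulHom g)
    (hf : IsComulHom f) : IsAntiComulHom (g ∘ₗ f) :=
  ⟨by simp [hf.counit, hg.counit], fun x => by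
    simp only [LinearMap.comp_apply, hf.comul, hg.comul, map_comp_apply]⟩

lemma IsComulHom.comp_anti {g : D →ₗ[k] E} {f : C →ₗ[k] D} (hg : IsComulHom g)
    (hf : IsAntiComulHom f) : IsAntiComulHom (g ∘ₗ f) :=
  ⟨by simp [hf.counit, hg.counit], fun x => by
    simp only [LinearMap.comp_apply, hf.comul, hg.comul, map_comp_apply, TensorProduct.map_comm]⟩

lemma IsComulHom.symm {f : C ≃ₗ[k] D} (hf : IsComulHom f.toLinearMap) :
    IsComulHom f.symm.toLinearMap := by
  constructor
  · intro x
    simpa using (hf.counit (f.symm x)).symm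
  · intro x
    have h := hf.comul (f.symm x)
    simp only [LinearEquiv.coe_coe, LinearEquiv.apply_symm_apply] at h ⊢
    rw [h, ← map_comp_apply]
    simp

lemma IsAntiComulHom.symm {f : C ≃ₗ[k] D} (hf : IsAntiComulHom f.toLinearMap) :
    IsAntiComulHom f.symm.toLinearMap := by
  constructor
  · intro x
    simpa using (hf.counit (f.symm x)).symm
  · intro x
    have h := hf.comul (f.symm x)
    simp only [LinearEquiv.coe_coe, LinearEquiv.apply_symm_apply] at h ⊢
    rw [h, TensorProduct.map_comm, comm_comm_apply, ← map_comp_apply]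
    simp

end Comul

section Conv

variable {C D A B : Type*} [AddCommGroup C] [Module k C] [Coalgebra k C]
  [AddCommGroup D] [Module k D] [Coalgebra k D] [Ring A] [Algebra k A] [Ring B] [Algebra k B]

/-- `f` and `g` are inverse to each other for the convolution product. -/
structure ConvInverse (f g : C →ₗ[k] A) : Prop where
  left : ∀ x, LinearMap.mul' k A (TensorProduct.map f g (Coalgebra.comul (R := k) x)) =
    algebraMap k A (Coalgebra.counit (R := k) x)
  right : ∀ x, LinearMap.mul' k A (TensorProduct.map g f (Coalgebra.comul (R := k) x)) =
    algebraMap k A (Coalgebra.counit (R := k) x)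

/-- `f` and `g` are inverse to each other for the convolution product defined by the
coopposite comultiplication. -/
structure SkewInverse (f g : C →ₗ[k] A) : Prop where
  left : ∀ x, LinearMap.mul' k A (TensorProduct.map f g
      (TensorProduct.comm k C C (Coalgebra.comul (R := k) x))) =
    algebraMap k A (Coalgebra.counit (R := k) x)
  right : ∀ x, LinearMap.mul' k A (TensorProduct.map g f
      (TensorProduct.comm k C C (Coalgebra.comul (R := k) x))) =
    algebraMap k A (Coalgebra.counit (R := k) x)

lemma SkewInverse.symm {f g : C →ₗ[k] A} (h : SkewInverse f g) : SkewInverse g f :=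
  ⟨h.right, h.left⟩

/-- Gives access to the monoid structure on `WithConv`, where inverses are unique. -/
lemma convInverse_iff {f g : C →ₗ[k] A} : ConvInverse f g ↔
    WithConv.toConv f * WithConv.toConv g = 1 ∧ WithConv.toConv g * WithConv.toConv f = 1 := by
  constructor
  · exact fun h => ⟨WithConv.ext (LinearMap.ext h.left), WithConv.ext (LinearMap.ext h.right)⟩
  · exact fun h => ⟨fun x => congr($(h.1).ofConv x), fun x => congr($(h.2).ofConv x)⟩

lemma ConvInverse.unique {f g g' : C →ₗ[k] A} (h : ConvInverse f g) (h' : ConvInverse f g') :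
    g = g' :=
  WithConv.toConv_injective
    (left_inv_eq_right_inv (convInverse_iff.1 h).2 (convInverse_iff.1 h').1)

omit [Coalgebra k C] in
lemma mul'_map_comp (h : A →ₗ[k] B) (hh : IsMulHom h) (f g : C →ₗ[k] A) (t : C ⊗[k] C) :
    LinearMap.mul' k B (TensorProduct.map (h ∘ₗ f) (h ∘ₗ g) t) =
      h (LinearMap.mul' k A (TensorProduct.map f g t)) := by
  induction t with
  | zero => simp
  | add x y hx hy => simp only [map_add, hx, hy]
  | tmul a b => simp [hh.map_mul]

omit [Coalgebra k C] in
lemma mul'_map_comp_anti (h : A →ₗ[k] B) (hh : IsAntiMulHom h) (f g : C →ₗ[k] A)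
    (t : C ⊗[k] C) :
    LinearMap.mul' k B (TensorProduct.map (h ∘ₗ f) (h ∘ₗ g) (TensorProduct.comm k C C t)) =
      h (LinearMap.mul' k A (TensorProduct.map g f t)) := by
  induction t with
  | zero => simp
  | add x y hx hy => simp only [map_add, hx, hy]
  | tmul a b => simp [hh.map_mul]

lemma IsMulHom.map_algebraMap {h : A →ₗ[k] B} (hh : IsMulHom h) (c : k) :
    h (algebraMap k A c) = algebraMap k B c := by
  rw [Algebra.algebraMap_eq_smul_one, map_smul, hh.map_one, Algebra.algebraMap_eq_smul_one]

lemma IsAntiMulHom.map_algebraMap {h : A →ₗ[k] B} (hh : IsAntiMulHom h) (c : k) :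
    h (algebraMap k A c) = algebraMap k B c := by
  rw [Algebra.algebraMap_eq_smul_one, map_smul, hh.map_one, Algebra.algebraMap_eq_smul_one]

lemma ConvInverse.mulHom_comp {f g : C →ₗ[k] A} (hfg : ConvInverse f g) {h : A →ₗ[k] B}
    (hh : IsMulHom h) : ConvInverse (h ∘ₗ f) (h ∘ₗ g) :=
  ⟨fun x => by rw [mul'_map_comp h hh, hfg.left, hh.map_algebraMap],
    fun x => by rw [mul'_map_comp h hh, hfg.right, hh.map_algebraMap]⟩

/-- Reversing the factors of a convolution product amounts to flipping the comultiplication. Each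
antimultiplicative map applied after, or anticomultiplicative map applied before, therefore
exchanges the two notions of inverse. -/
lemma ConvInverse.antiMulHom_comp {f g : C →ₗ[k] A} (hfg : ConvInverse f g) {h : A →ₗ[k] B}
    (hh : IsAntiMulHom h) : SkewInverse (h ∘ₗ f) (h ∘ₗ g) :=
  ⟨fun x => by rw [mul'_map_comp_anti h hh, hfg.right, hh.map_algebraMap],
    fun x => by rw [mul'_map_comp_anti h hh, hfg.left, hh.map_algebraMap]⟩

lemma SkewInverse.antiMulHom_comp {f g : C →ₗ[k] A} (hfg : SkewInverse f g) {h : A →ₗ[k] B}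
    (hh : IsAntiMulHom h) : ConvInverse (h ∘ₗ f) (h ∘ₗ g) := by
  have key (f g : C →ₗ[k] A) (t : C ⊗[k] C) := mul'_map_comp_anti h hh f g
    (TensorProduct.comm k C C t)
  simp only [comm_comm_apply] at key
  exact ⟨fun x => by rw [key, hfg.right, hh.map_algebraMap],
    fun x => by rw [key, hfg.left, hh.map_algebraMap]⟩

lemma ConvInverse.comp_comulHom {f g : C →ₗ[k] A} (hfg : ConvInverse f g) {p : D →ₗ[k] C}
    (hp : IsComulHom p) : ConvInverse (f ∘ₗ p) (g ∘ₗ p) :=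
  ⟨fun x => by rw [map_comp_apply, ← hp.comul, hfg.left, hp.counit],
    fun x => by rw [map_comp_apply, ← hp.comul, hfg.right, hp.counit]⟩

lemma ConvInverse.comp_antiComulHom {f g : C →ₗ[k] A} (hfg : ConvInverse f g) {p : D →ₗ[k] C}
    (hp : IsAntiComulHom p) : SkewInverse (f ∘ₗ p) (g ∘ₗ p) :=
  ⟨fun x => by rw [map_comp_apply, TensorProduct.map_comm, ← hp.comul, hfg.left, hp.counit],
    fun x => by rw [map_comp_apply, TensorProduct.map_comm, ← hp.comul, hfg.right, hp.counit]⟩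

lemma SkewInverse.comp_antiComulHom {f g : C →ₗ[k] A} (hfg : SkewInverse f g) {p : D →ₗ[k] C}
    (hp : IsAntiComulHom p) : ConvInverse (f ∘ₗ p) (g ∘ₗ p) := by
  have key (x : D) : TensorProduct.map p p (Coalgebra.comul (R := k) x) =
      TensorProduct.comm k C C (Coalgebra.comul (R := k) (p x)) := by
    rw [hp.comul, comm_comm_apply]
  exact ⟨fun x => by rw [map_comp_apply, key, hfg.left, hp.counit],
    fun x => by rw [map_comp_apply, key, hfg.right, hp.counit]⟩

/-- In the opposite algebra skew inverses become ordinary convolution inverses. -/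
lemma SkewInverse.unique {f g g' : C →ₗ[k] A} (h : SkewInverse f g) (h' : SkewInverse f g') :
    g = g' := by
  have := (h.antiMulHom_comp isAntiMulHom_op).unique (h'.antiMulHom_comp isAntiMulHom_op)
  ext x
  exact (MulOpposite.opLinearEquiv k).injective (LinearMap.congr_fun this x)

/-- The comultiplication followed by `f ⊗ f` is inverse to the coopposite comultiplication
followed by `g ⊗ g`. -/
lemma ConvInverse.comul {f g : C →ₗ[k] A} (h : ConvInverse f g) :
    ConvInverse (TensorProduct.map f f ∘ₗ Coalgebra.comul)
      ((TensorProduct.comm k A A).toLinearMap ∘ₗ TensorProduct.map g g ∘ₗ Coalgebra.comul) := by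
  set i₁ : A →ₗ[k] A ⊗[k] A :=
    (Algebra.TensorProduct.includeLeft : A →ₐ[k] A ⊗[k] A).toLinearMap with hi₁
  set i₂ : A →ₗ[k] A ⊗[k] A :=
    (Algebra.TensorProduct.includeRight : A →ₐ[k] A ⊗[k] A).toLinearMap with hi₂
  have h₁ := convInverse_iff.1 (h.mulHom_comp (isMulHom_algHom
    (Algebra.TensorProduct.includeLeft : A →ₐ[k] A ⊗[k] A)))
  have h₂ := convInverse_iff.1 (h.mulHom_comp (isMulHom_algHom
    (Algebra.TensorProduct.includeRight : A →ₐ[k] A ⊗[k] A)))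
  rw [← hi₁] at h₁
  rw [← hi₂] at h₂
  have e₁ : WithConv.toConv (TensorProduct.map f f ∘ₗ Coalgebra.comul) =
      WithConv.toConv (i₁ ∘ₗ f) * WithConv.toConv (i₂ ∘ₗ f) := by
    refine WithConv.ext (LinearMap.ext fun x => ?_)
    have key (t : C ⊗[k] C) : TensorProduct.map f f t =
        LinearMap.mul' k (A ⊗[k] A) (TensorProduct.map (i₁ ∘ₗ f) (i₂ ∘ₗ f) t) := by
      induction t with
      | zero => simp
      | add x y hx hy => simp only [map_add, hx, hy]
      | tmul a b => simp [hi₁, hi₂]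
    exact key _
  have e₂ : WithConv.toConv
      ((TensorProduct.comm k A A).toLinearMap ∘ₗ TensorProduct.map g g ∘ₗ Coalgebra.comul) =
      WithConv.toConv (i₂ ∘ₗ g) * WithConv.toConv (i₁ ∘ₗ g) := by
    refine WithConv.ext (LinearMap.ext fun x => ?_)
    have key (t : C ⊗[k] C) : TensorProduct.comm k A A (TensorProduct.map g g t) =
        LinearMap.mul' k (A ⊗[k] A) (TensorProduct.map (i₂ ∘ₗ g) (i₁ ∘ₗ g) t) := by
      induction t with
      | zero => simp
      | add x y hx hy => simp only [map_add, hx, hy]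
      | tmul a b => simp [hi₁, hi₂]
    exact key _
  -- In the convolution monoid the two maps are products `a * b` and `b⁻¹ * a⁻¹`, so both composites
  -- cancel from the middle.
  rw [convInverse_iff, e₁, e₂]
  constructor
  · rw [mul_assoc, ← mul_assoc (WithConv.toConv (i₂ ∘ₗ f)), h₂.1, one_mul, h₁.1]
  · rw [mul_assoc, ← mul_assoc (WithConv.toConv (i₁ ∘ₗ g)), h₁.2, one_mul, h₂.2]

end Conv

end Predicates

/-! ### Antipodes and bialgebra maps. -/

section Hopf

variable {k : Type*} [CommRing k]

section

variable {A B : Type*} [Ring A] [Bialgebra k A] [Ring B] [Bialgebra k B]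

lemma isMulHom_bialgHom (f : A →ₐc[k] B) : IsMulHom (f : A →ₗ[k] B) :=
  ⟨map_one f, map_mul f⟩

lemma isComulHom_bialgHom (f : A →ₐc[k] B) : IsComulHom (f : A →ₗ[k] B) :=
  ⟨fun x => CoalgHomClass.counit_comp_apply f x,
    fun x => (CoalgHomClass.map_comp_comul_apply f x).symm⟩

/-- A linear map respecting both structures as a bialgebra map. -/
def toBialgHom (f : A →ₗ[k] B) (hf : IsMulHom f) (hf' : IsComulHom f) : A →ₐc[k] B :=
  BialgHom.ofAlgHom hf.toAlgHom (AlgHom.ext hf'.counit)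
    (AlgHom.ext fun x => (hf'.comul x).symm)

end

variable {H K : Type*} [Ring H] [HopfAlgebra k H] [Ring K] [HopfAlgebra k K]

lemma convInverse_antipode : ConvInverse (LinearMap.id : H →ₗ[k] H) (HopfAlgebra.antipode k) :=
  ⟨HopfAlgebra.mul_antipode_lTensor_comul_apply, HopfAlgebra.mul_antipode_rTensor_comul_apply⟩

lemma isAntiMulHom_antipode : IsAntiMulHom (HopfAlgebra.antipode k : H →ₗ[k] H) :=
  ⟨HopfAlgebra.antipode_one, HopfAlgebra.antipode_mul_antidistrib⟩

/-- The composite of the antipode with `Δ`, and the flip of `(S ⊗ S) ∘ Δ`, are both convolution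
inverses of `Δ : H → H ⊗ H`. -/
lemma isAntiComulHom_antipode : IsAntiComulHom (HopfAlgebra.antipode k : H →ₗ[k] H) := by
  refine ⟨HopfAlgebra.counit_antipode, fun x => ?_⟩
  have h₁ := (convInverse_antipode (k := k) (H := H)).comul
  rw [TensorProduct.map_id, LinearMap.id_comp] at h₁
  have h₂ := (convInverse_antipode (k := k) (H := H)).mulHom_comp
    (isMulHom_algHom (Bialgebra.comulAlgHom k H))
  exact LinearMap.congr_fun (h₂.unique h₁) x

/-- Both sides are convolution inverses of `f`. -/
lemma antipode_comp_bialgHom (f : H →ₐc[k] K) :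
    HopfAlgebra.antipode k ∘ₗ (f : H →ₗ[k] K) = (f : H →ₗ[k] K) ∘ₗ HopfAlgebra.antipode k :=
  (convInverse_antipode.comp_comulHom (isComulHom_bialgHom f)).unique
    (convInverse_antipode.mulHom_comp (isMulHom_bialgHom f))

lemma antipode_bialgHom_apply (f : H →ₐc[k] K) (x : H) :
    HopfAlgebra.antipode k (f x) = f (HopfAlgebra.antipode k x) :=
  LinearMap.congr_fun (antipode_comp_bialgHom f) x

end Hopf


/-! ### Subcoalgebras and their size. -/

section OfInjective

variable {k : Type*} [Field k] {W X : Type*} [AddCommGroup W] [Module k W]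
  [AddCommGroup X] [Module k X] [Coalgebra k X]

lemma map_injective_of_injective {M N M' N' : Type*} [AddCommGroup M] [AddCommGroup N]
    [AddCommGroup M'] [AddCommGroup N'] [Module k M] [Module k N] [Module k M'] [Module k N']
    {f : M →ₗ[k] N} {g : M' →ₗ[k] N'} (hf : Function.Injective f) (hg : Function.Injective g) :
    Function.Injective (TensorProduct.map f g) :=
  TensorProduct.map_injective_of_flat_flat f g hf hg

/-- The comultiplication of a subspace whose comultiples stay inside. -/
noncomputable def comulOfInjective (i : W →ₗ[k] X) (hi : Function.Injective i)
    (h : ∀ w, Coalgebra.comul (R := k) (i w) ∈ LinearMap.range (TensorProduct.map i i)) :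
    W →ₗ[k] W ⊗[k] W :=
  (LinearEquiv.ofInjective _ (map_injective_of_injective hi hi)).symm.toLinearMap ∘ₗ
    (Coalgebra.comul ∘ₗ i).codRestrict _ h

lemma map_comulOfInjective (i : W →ₗ[k] X) (hi : Function.Injective i)
    (h : ∀ w, Coalgebra.comul (R := k) (i w) ∈ LinearMap.range (TensorProduct.map i i)) (w : W) :
    TensorProduct.map i i (comulOfInjective i hi h w) = Coalgebra.comul (R := k) (i w) :=
  congrArg Subtype.val ((LinearEquiv.ofInjective _
    (map_injective_of_injective hi hi)).apply_symm_apply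
      ((Coalgebra.comul ∘ₗ i).codRestrict _ h w))

/-- A subspace whose comultiples stay inside is a coalgebra. -/
noncomputable abbrev coalgebraOfInjective (i : W →ₗ[k] X) (hi : Function.Injective i)
    (h : ∀ w, Coalgebra.comul (R := k) (i w) ∈ LinearMap.range (TensorProduct.map i i)) :
    Coalgebra k W where
  comul := comulOfInjective i hi h
  counit := Coalgebra.counit ∘ₗ i
  coassoc := by
    have key₁ (t : W ⊗[k] W) : TensorProduct.map i (TensorProduct.map i i)
        (TensorProduct.assoc k W W W (LinearMap.rTensor W (comulOfInjective i hi h) t)) =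
        TensorProduct.assoc k X X X (LinearMap.rTensor X Coalgebra.comul
          (TensorProduct.map i i t)) := by
      induction t with
      | zero => simp
      | add x y hx hy => simp only [map_add, hx, hy]
      | tmul a b =>
        simp only [LinearMap.rTensor_tmul, TensorProduct.map_tmul, ← map_comulOfInjective i hi h]
        generalize comulOfInjective i hi h a = s
        induction s with
        | zero => simp
        | add x y hx hy => simp only [map_add, TensorProduct.add_tmul, hx, hy]
        | tmul c d => simp
    have key₂ (t : W ⊗[k] W) : TensorProduct.map i (TensorProduct.map i i)
        (LinearMap.lTensor W (comulOfInjective i hi h) t) =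
        LinearMap.lTensor X Coalgebra.comul (TensorProduct.map i i t) := by
      induction t with
      | zero => simp
      | add x y hx hy => simp only [map_add, hx, hy]
      | tmul a b => simp [map_comulOfInjective i hi h]
    ext w
    -- Over a field the tensor powers of `i` stay injective, so each axiom may be checked in `X`.
    apply map_injective_of_injective hi (map_injective_of_injective hi hi)
    simp only [LinearMap.comp_apply, LinearEquiv.coe_coe]
    rw [key₁, key₂, map_comulOfInjective i hi h, Coalgebra.coassoc_apply]
  rTensor_counit_comp_comul := by
    have key (t : W ⊗[k] W) : LinearMap.lTensor k i
        (LinearMap.rTensor W (Coalgebra.counit ∘ₗ i) t) =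
        LinearMap.rTensor X Coalgebra.counit (TensorProduct.map i i t) := by
      induction t with
      | zero => simp
      | add x y hx hy => simp only [map_add, hx, hy]
      | tmul a b => simp
    ext w
    apply map_injective_of_injective (f := LinearMap.id) Function.injective_id hi
    refine (key _).trans ?_
    rw [map_comulOfInjective i hi h]
    simp
  lTensor_counit_comp_comul := by
    have key (t : W ⊗[k] W) : LinearMap.rTensor k i
        (LinearMap.lTensor W (Coalgebra.counit ∘ₗ i) t) =
        LinearMap.lTensor X Coalgebra.counit (TensorProduct.map i i t) := by
      induction t with
      | zero => simp
      | add x y hx hy => simp only [map_add, hx, hy]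
      | tmul a b => simp
    ext w
    apply map_injective_of_injective (g := LinearMap.id) hi Function.injective_id
    refine (key _).trans ?_
    rw [map_comulOfInjective i hi h]
    simp

lemma isComulHom_ofInjective (i : W →ₗ[k] X) (hi : Function.Injective i)
    (h : ∀ w, Coalgebra.comul (R := k) (i w) ∈ LinearMap.range (TensorProduct.map i i)) :
    letI := coalgebraOfInjective i hi h
    IsComulHom i :=
  letI := coalgebraOfInjective i hi h
  ⟨fun _ => rfl, fun w => (map_comulOfInjective i hi h w).symm⟩

/-- `C` is a subcoalgebra of the coalgebra `X`. -/
def IsSubcoalg (C : Submodule k X) : Prop :=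
  ∀ x ∈ C, Coalgebra.comul (R := k) x ∈ LinearMap.range (TensorProduct.map C.subtype C.subtype)

omit [Coalgebra k X] in
lemma range_map_subtype_mono {C D : Submodule k X} (h : C ≤ D) :
    LinearMap.range (TensorProduct.map C.subtype C.subtype) ≤
      LinearMap.range (TensorProduct.map D.subtype D.subtype) := by
  rintro _ ⟨t, rfl⟩
  refine ⟨TensorProduct.map (Submodule.inclusion h) (Submodule.inclusion h) t, ?_⟩
  rw [← map_comp_apply]
  rfl

lemma isSubcoalg_sSup {S : Set (Submodule k X)} (hS : ∀ C ∈ S, IsSubcoalg C) :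
    IsSubcoalg (sSup S) := by
  have : sSup S ≤ (LinearMap.range (TensorProduct.map (sSup S).subtype (sSup S).subtype)).comap
      Coalgebra.comul :=
    sSup_le fun C hC x hx => range_map_subtype_mono (le_sSup hC) (hS C hC x hx)
  exact this

lemma isSubcoalg_sup {C D : Submodule k X} (hC : IsSubcoalg C) (hD : IsSubcoalg D) :
    IsSubcoalg (C ⊔ D) := by
  rw [← sSup_pair]
  apply isSubcoalg_sSup
  rintro _ (rfl | rfl) <;> assumption

lemma exists_finite_comul_mem (x : X) : ∃ s : Set X, s.Finite ∧
    Coalgebra.comul (R := k) x ∈ LinearMap.range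
      (TensorProduct.map (Submodule.span k s).subtype (Submodule.span k s).subtype) := by
  generalize Coalgebra.comul (R := k) x = t
  induction t with
  | zero => exact ⟨∅, Set.finite_empty, zero_mem _⟩
  | add a b ha hb =>
    obtain ⟨s, hs, hs'⟩ := ha
    obtain ⟨t, ht, ht'⟩ := hb
    exact ⟨s ∪ t, hs.union ht, add_mem
      (range_map_subtype_mono (Submodule.span_mono Set.subset_union_left) hs')
      (range_map_subtype_mono (Submodule.span_mono Set.subset_union_right) ht')⟩
  | tmul a b =>
    refine ⟨{a, b}, Set.toFinite _, ?_⟩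
    exact ⟨⟨a, Submodule.subset_span (by simp)⟩ ⊗ₜ ⟨b, Submodule.subset_span (by simp)⟩, rfl⟩

/-- Every element of a coalgebra lies in a countably spanned subcoalgebra. -/
lemma exists_countable_subcoalg (x : X) : ∃ s : Set X, s.Countable ∧ x ∈ s ∧
    IsSubcoalg (Submodule.span k s) := by
  choose F hF hF' using exists_finite_comul_mem (k := k) (X := X)
  -- Each stage adds finitely many vectors for every `y` already present, enough to express `Δ(y)`.
  -- The union of the stages is thus closed under `Δ` and still countable.
  let s : ℕ → Set X := fun n => Nat.rec {x} (fun _ t => ⋃ y ∈ t, F y) n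
  have hs (n : ℕ) : (s n).Countable := by
    induction n with
    | zero => exact Set.countable_singleton x
    | succ n ih => exact ih.biUnion fun y _ => (hF y).countable
  refine ⟨⋃ n, s n, Set.countable_iUnion hs, Set.mem_iUnion.2 ⟨0, rfl⟩, ?_⟩
  have : Submodule.span k (⋃ n, s n) ≤ (LinearMap.range (TensorProduct.map
      (Submodule.span k (⋃ n, s n)).subtype (Submodule.span k (⋃ n, s n)).subtype)).comap
      Coalgebra.comul := by
    rw [Submodule.span_le]
    intro y hy
    obtain ⟨n, hn⟩ := Set.mem_iUnion.1 hy
    refine range_map_subtype_mono (Submodule.span_mono ?_) (hF' y)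
    intro z hz
    exact Set.mem_iUnion.2 ⟨n + 1, Set.mem_biUnion hn hz⟩
  exact this

/-- A linear section of the map from the free space on `s` onto `W`, followed by an enumeration of
`s`, embeds `W`. This puts all countably spanned spaces inside one fixed space, so that the cones
below form a type in `Type u`. -/
lemma exists_injective_of_countable {s : Set W} (hs : s.Countable)
    (hs' : Submodule.span k s = ⊤) : ∃ j : W →ₗ[k] (ℕ →₀ k), Function.Injective j := by
  have := hs.to_subtype
  obtain ⟨e, he⟩ := exists_injective_nat s
  obtain ⟨r, hr⟩ := LinearMap.exists_rightInverse_of_surjective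
    (Finsupp.linearCombination k ((↑) : s → W)) (by
      rw [Finsupp.range_linearCombination, Subtype.range_coe, hs'])
  refine ⟨Finsupp.lmapDomain k k e ∘ₗ r, ?_⟩
  refine (Finsupp.mapDomain_injective he).comp ?_
  exact Function.LeftInverse.injective (g := Finsupp.linearCombination k ((↑) : s → W))
    fun w => LinearMap.congr_fun hr w

end OfInjective

/-! ### Products of coalgebras. -/

section CoalgProduct

variable {k : Type u} [Field k] {ι : Type} (B : ι → Type u) [∀ i, AddCommGroup (B i)]
  [∀ i, Module k (B i)] [∀ i, Coalgebra k (B i)]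

/-- A subspace of the space of countable dimension, as a type. -/
def CountableSpace (S : Submodule k (ℕ →₀ k)) : Type u := S

noncomputable instance (S : Submodule k (ℕ →₀ k)) : AddCommGroup (CountableSpace S) :=
  inferInstanceAs (AddCommGroup S)

noncomputable instance (S : Submodule k (ℕ →₀ k)) : Module k (CountableSpace S) :=
  inferInstanceAs (Module k S)

variable (k) in
/-- A coalgebra of countable dimension with coalgebra maps to all the `B i`. -/
structure CountableCone where
  /-- the underlying subspace -/
  space : Submodule k (ℕ →₀ k)
  /-- the coalgebra structure -/
  [coalgebra : Coalgebra k (CountableSpace space)]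
  /-- the maps -/
  hom : ∀ i, CountableSpace space →ₗc[k] B i

attribute [instance] CountableCone.coalgebra

/-- The carrier of a cone. -/
abbrev CountableCone.carrier (w : CountableCone k B) : Type u := CountableSpace w.space

variable (k) in
/-- The direct sum of all coalgebras of countable dimension over the `B i`. -/
abbrev ConeSum : Type u := Π₀ w : CountableCone k B, w.carrier

open Classical in
noncomputable instance : Coalgebra k (ConeSum k B) := DFinsupp.instCoalgebra k _ _

open Classical in
variable (k) in
/-- The maps from the direct sum to the `B i`. -/
noncomputable def coneSumProj (i : ι) : ConeSum k B →ₗ[k] B i :=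
  DFinsupp.lsum k fun w => (w.hom i).toLinearMap

open Classical in
variable (k) in
/-- The summands of the direct sum. -/
noncomputable def coneSumIn (w : CountableCone k B) : w.carrier →ₗ[k] ConeSum k B :=
  DFinsupp.lsingle (M := fun w : CountableCone k B => w.carrier) w

lemma isComulHom_coneSumIn (w : CountableCone k B) : IsComulHom (coneSumIn k B w) := by
  classical
  exact ⟨fun x => DFinsupp.counit_single k _ _ w x, fun x => DFinsupp.comul_single k _ _ w x⟩

lemma coneSumProj_coneSumIn (w : CountableCone k B) (i : ι) (x : w.carrier) :
    coneSumProj k B i (coneSumIn k B w x) = w.hom i x := by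
  classical
  exact DFinsupp.lsum_single (S := k) (fun w : CountableCone k B => (w.hom i).toLinearMap) w x

lemma coneSum_hom_ext {M : Type*} [AddCommGroup M] [Module k M] {f g : ConeSum k B →ₗ[k] M}
    (h : ∀ w x, f (coneSumIn k B w x) = g (coneSumIn k B w x)) : f = g := by
  classical
  exact DFinsupp.lhom_ext h

lemma isComulHom_coneSumProj (i : ι) : IsComulHom (coneSumProj k B i) := by
  constructor
  · refine LinearMap.congr_fun (f := Coalgebra.counit ∘ₗ coneSumProj k B i)
      (coneSum_hom_ext B fun w x => ?_)
    simp [coneSumProj_coneSumIn, (isComulHom_coneSumIn B w).counit]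
  · refine LinearMap.congr_fun (f := Coalgebra.comul ∘ₗ coneSumProj k B i)
      (g := TensorProduct.map (coneSumProj k B i) (coneSumProj k B i) ∘ₗ Coalgebra.comul)
      (coneSum_hom_ext B fun w x => ?_)
    have : coneSumProj k B i ∘ₗ coneSumIn k B w = (w.hom i).toLinearMap :=
      LinearMap.ext fun x => coneSumProj_coneSumIn B w i x
    simp only [LinearMap.comp_apply, (isComulHom_coneSumIn B w).comul, ← map_comp_apply, this,
      coneSumProj_coneSumIn]
    exact (isComulHom_coalgHom (w.hom i)).comul x

variable (k) in
/-- The coideals contained in the kernels of all the maps to the `B i`. -/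
def negligibleCoideals : Set (Submodule k (ConeSum k B)) :=
  {J | J.IsCoideal ∧ ∀ i, J ≤ LinearMap.ker (coneSumProj k B i)}

variable (k) in
/-- The largest coideal contained in the kernels of all the maps to the `B i`. -/
noncomputable def negligible : Submodule k (ConeSum k B) := sSup (negligibleCoideals k B)

lemma map_mkQ_eq_zero_of_le {M : Type*} [AddCommGroup M] [Module k M] {I J : Submodule k M}
    (h : J ≤ I) {t : M ⊗[k] M} (ht : TensorProduct.map J.mkQ J.mkQ t = 0) :
    TensorProduct.map I.mkQ I.mkQ t = 0 := by
  have : I.mkQ = J.liftQ I.mkQ (by simpa using h) ∘ₗ J.mkQ := (J.liftQ_mkQ _ _).symm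
  rw [this, map_comp_apply, ht, map_zero]

instance : (negligible k B).IsCoideal where
  counit_eq_zero := by
    have : negligible k B ≤ LinearMap.ker Coalgebra.counit :=
      sSup_le fun J hJ x hx => hJ.1.counit_eq_zero hx
    exact this
  map_mkQ_comul_eq_zero := by
    have : negligible k B ≤ LinearMap.ker (TensorProduct.map (negligible k B).mkQ
        (negligible k B).mkQ ∘ₗ Coalgebra.comul) :=
      sSup_le fun J hJ x hx =>
        map_mkQ_eq_zero_of_le (le_sSup hJ) (hJ.1.map_mkQ_comul_eq_zero hx)
    exact this

lemma negligible_le_ker (i : ι) : negligible k B ≤ LinearMap.ker (coneSumProj k B i) :=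
  sSup_le fun _ hJ => hJ.2 i

variable (k) in
/-- The product of the coalgebras `B i`. -/
abbrev CoalgProd : Type u := ConeSum k B ⧸ negligible k B

variable (k) in
/-- The projections of the product of coalgebras. -/
noncomputable def coalgProdProj (i : ι) : CoalgProd k B →ₗc[k] B i :=
  IsComulHom.toCoalgHom (f := (negligible k B).liftQ (coneSumProj k B i) (negligible_le_ker B i)) (by
    constructor
    · intro x
      obtain ⟨x, rfl⟩ := Submodule.Quotient.mk_surjective _ x
      exact (isComulHom_coneSumProj B i).counit x
    · intro x
      obtain ⟨x, rfl⟩ := Submodule.Quotient.mk_surjective _ x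
      rw [Coalgebra.Quotient.comul_mk, ← map_comp_apply, Submodule.liftQ_mkQ]
      exact (isComulHom_coneSumProj B i).comul x)

/-- Two coalgebra maps agree modulo the range of their difference, which is thus a coideal. -/
lemma isCoideal_range_sub {X T : Type*} [AddCommGroup X] [Module k X] [Coalgebra k X]
    [AddCommGroup T] [Module k T] [Coalgebra k T] (f g : X →ₗc[k] T) :
    (LinearMap.range (f.toLinearMap - g.toLinearMap)).IsCoideal where
  counit_eq_zero := by
    rintro _ ⟨x, rfl⟩
    simp
  map_mkQ_comul_eq_zero := by
    rintro _ ⟨x, rfl⟩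
    have h : (LinearMap.range (f.toLinearMap - g.toLinearMap)).mkQ ∘ₗ f.toLinearMap =
        (LinearMap.range (f.toLinearMap - g.toLinearMap)).mkQ ∘ₗ g.toLinearMap := by
      ext x
      exact (Submodule.Quotient.eq _).2 ⟨x, rfl⟩
    rw [LinearMap.sub_apply, map_sub, map_sub, (isComulHom_coalgHom f).comul,
      (isComulHom_coalgHom g).comul, ← map_comp_apply, ← map_comp_apply, h, sub_self]

/-- The quotient by the preimage of `J` is the iterated quotient by `I` and then `J`. Coideals of
the product can thus be compared with `negligible`, which lives in the direct sum. -/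
lemma isCoideal_comap_mkQ {X : Type*} [AddCommGroup X] [Module k X] [Coalgebra k X]
    (I : Submodule k X) [I.IsCoideal] (J : Submodule k (X ⧸ I)) (hJ : J.IsCoideal) :
    (J.comap I.mkQ).IsCoideal where
  counit_eq_zero := fun x hx => hJ.counit_eq_zero (x := I.mkQ x) hx
  map_mkQ_comul_eq_zero := by
    intro x hx
    have hI : I ≤ LinearMap.ker (J.comap I.mkQ).mkQ := by
      rw [Submodule.ker_mkQ]
      intro y hy
      have : I.mkQ y = 0 := (Submodule.Quotient.mk_eq_zero I).2 hy
      rw [Submodule.mem_comap, this]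
      exact zero_mem J
    have hJ' : J ≤ LinearMap.ker (I.liftQ (J.comap I.mkQ).mkQ hI) := by
      intro y hy
      obtain ⟨y, rfl⟩ := I.mkQ_surjective y
      exact (Submodule.Quotient.mk_eq_zero _).2 hy
    have e : (J.comap I.mkQ).mkQ = (J.liftQ _ hJ' ∘ₗ J.mkQ) ∘ₗ I.mkQ := by
      rw [Submodule.liftQ_mkQ, Submodule.liftQ_mkQ]
    have h := hJ.map_mkQ_comul_eq_zero (x := I.mkQ x) hx
    rw [e, map_comp_apply, map_comp_apply]
    exact (congrArg _ h).trans (map_zero _)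

/-- The range of `f - g` is a coideal killed by every projection. Its preimage in the direct sum is
then one of the coideals whose sum has been divided out, so the range vanishes. -/
lemma coalgProd_hom_ext {X : Type*} [AddCommGroup X] [Module k X] [Coalgebra k X]
    {f g : X →ₗc[k] CoalgProd k B}
    (h : ∀ i x, coalgProdProj k B i (f x) = coalgProdProj k B i (g x)) : f = g := by
  set J := LinearMap.range (f.toLinearMap - g.toLinearMap) with hJ
  have hle : J.comap (negligible k B).mkQ ≤ negligible k B := by
    refine le_sSup ⟨isCoideal_comap_mkQ _ _ (isCoideal_range_sub f g), fun i x hx => ?_⟩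
    obtain ⟨y, hy⟩ := hx
    change coalgProdProj k B i ((negligible k B).mkQ x) = 0
    rw [← hy]
    simp [h]
  ext x
  rw [← sub_eq_zero]
  obtain ⟨y, hy⟩ := (negligible k B).mkQ_surjective (f x - g x)
  rw [← hy]
  refine (Submodule.Quotient.mk_eq_zero _).2 (hle ?_)
  rw [Submodule.mem_comap, hy]
  exact ⟨x, rfl⟩

lemma exists_countableCone {X : Type*} [AddCommGroup X] [Module k X]
    [Coalgebra k X] {s : Set X} (hs : s.Countable) (hs' : Submodule.span k s = ⊤)
    (f : ∀ i, X →ₗc[k] B i) : ∃ (w : CountableCone k B) (e : X →ₗ[k] w.carrier),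
      IsComulHom e ∧ ∀ i x, w.hom i (e x) = f i x := by
  obtain ⟨j, hj⟩ := exists_injective_of_countable hs hs'
  let e : X ≃ₗ[k] CountableSpace (LinearMap.range j) := LinearEquiv.ofInjective j hj
  have h (w : CountableSpace (LinearMap.range j)) :
      Coalgebra.comul (R := k) (e.symm.toLinearMap w) ∈
        LinearMap.range (TensorProduct.map e.symm.toLinearMap e.symm.toLinearMap) := by
    refine ⟨TensorProduct.map e.toLinearMap e.toLinearMap
      (Coalgebra.comul (R := k) (e.symm w)), ?_⟩
    rw [← map_comp_apply]
    simp
  let inst : Coalgebra k (CountableSpace (LinearMap.range j)) :=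
    coalgebraOfInjective e.symm.toLinearMap e.symm.injective h
  have he : IsComulHom e.symm.toLinearMap :=
    isComulHom_ofInjective e.symm.toLinearMap e.symm.injective h
  exact ⟨⟨LinearMap.range j, fun i => (f i).comp he.toCoalgHom⟩, e.toLinearMap, he.symm,
    fun i x => congrArg (f i) (e.symm_apply_apply x)⟩

lemma exists_coalgProd_lift_of_countable {X : Type*} [AddCommGroup X] [Module k X]
    [Coalgebra k X] {s : Set X} (hs : s.Countable) (hs' : Submodule.span k s = ⊤)
    (f : ∀ i, X →ₗc[k] B i) :
    ∃ g : X →ₗc[k] CoalgProd k B, ∀ i x, coalgProdProj k B i (g x) = f i x := by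
  obtain ⟨w, e, he, h⟩ := exists_countableCone B hs hs' f
  refine ⟨(Coalgebra.Quotient.mkQCoalgHom (negligible k B)).comp
    ((isComulHom_coneSumIn B w).toCoalgHom.comp he.toCoalgHom), fun i x => ?_⟩
  exact (coneSumProj_coneSumIn B w i (e x)).trans (h i x)

/-- `X` is the directed union of its countably spanned subcoalgebras. On each of them a lift exists
because it is a summand of the direct sum up to isomorphism, and uniqueness of these lifts makes
them glue. -/
lemma exists_coalgProd_lift {X : Type*} [AddCommGroup X] [Module k X] [Coalgebra k X]
    (f : ∀ i, X →ₗc[k] B i) :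
    ∃ g : X →ₗc[k] CoalgProd k B, ∀ i x, coalgProdProj k B i (g x) = f i x := by
  -- the lifts on countably spanned subcoalgebras, which are unique
  have key (C : Submodule k X) (hC : IsSubcoalg C ∧ ∃ s : Set X, s.Countable ∧
      Submodule.span k s = C) : ∃ g : C →ₗ[k] CoalgProd k B,
        (∀ i x, coalgProdProj k B i (g x) = f i x) ∧
        (∀ x, Coalgebra.counit (R := k) (g x) = Coalgebra.counit (R := k) (x : X)) ∧
        -- Comultiplicativity is phrased through preimages `t` of `Δ(x)`, so that it does not refer
        -- to the coalgebra structure put locally on `C`.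
        (∀ (x : C) (t : C ⊗[k] C),
          TensorProduct.map C.subtype C.subtype t = Coalgebra.comul (R := k) (x : X) →
          Coalgebra.comul (R := k) (g x) = TensorProduct.map g g t) := by
    have hC₀ (x : C) : Coalgebra.comul (R := k) (C.subtype x) ∈
        LinearMap.range (TensorProduct.map C.subtype C.subtype) := hC.1 x x.2
    let inst : Coalgebra k C := coalgebraOfInjective C.subtype C.injective_subtype hC₀
    have hi : IsComulHom C.subtype := isComulHom_ofInjective C.subtype C.injective_subtype hC₀
    obtain ⟨s, hs, hs'⟩ := hC.2
    obtain ⟨g, hg⟩ := exists_coalgProd_lift_of_countable B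
      (s := ((↑) : C → X) ⁻¹' s) (hs.preimage Subtype.val_injective)
      (by subst hs'; exact Submodule.span_span_coe_preimage)
      fun i => (f i).comp hi.toCoalgHom
    refine ⟨g.toLinearMap, hg, (isComulHom_coalgHom g).counit, fun x t ht => ?_⟩
    refine ((isComulHom_coalgHom g).comul x).trans ?_
    congr 1
    apply map_injective_of_injective C.injective_subtype C.injective_subtype
    rw [ht]
    exact (hi.comul x).symm
  choose g hg hg' hg'' using key
  have compat (C D : Submodule k X) (hC) (hD) (hCD : C ≤ D) (x : C) :
      g C hC x = g D hD (Submodule.inclusion hCD x) := by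
    have hC₀ (x : C) : Coalgebra.comul (R := k) (C.subtype x) ∈
        LinearMap.range (TensorProduct.map C.subtype C.subtype) := hC.1 x x.2
    let inst : Coalgebra k C := coalgebraOfInjective C.subtype C.injective_subtype hC₀
    have hi : IsComulHom C.subtype := isComulHom_ofInjective C.subtype C.injective_subtype hC₀
    have h₁ : IsComulHom (g C hC) :=
      ⟨hg' C hC, fun x => hg'' C hC x _ (hi.comul x).symm⟩
    have h₂ : IsComulHom (g D hD ∘ₗ Submodule.inclusion hCD) := by
      refine ⟨fun x => hg' D hD _, fun x => ?_⟩
      rw [map_comp_apply]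
      refine hg'' D hD _ _ ?_
      rw [← map_comp_apply]
      exact (hi.comul x).symm
    have h := coalgProd_hom_ext B (f := h₁.toCoalgHom) (g := h₂.toCoalgHom)
      fun i x => (hg C hC i x).trans (hg D hD i (Submodule.inclusion hCD x)).symm
    exact congr($h x)
  have cover (x : X) : ∃ C : Submodule k X, (IsSubcoalg C ∧ ∃ s : Set X, s.Countable ∧
      Submodule.span k s = C) ∧ x ∈ C := by
    obtain ⟨s, hs, hx, hs'⟩ := exists_countable_subcoalg (k := k) x
    exact ⟨_, ⟨hs', s, hs, rfl⟩, Submodule.subset_span hx⟩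
  have sup (C D : Submodule k X)
      (hC : IsSubcoalg C ∧ ∃ s : Set X, s.Countable ∧ Submodule.span k s = C)
      (hD : IsSubcoalg D ∧ ∃ s : Set X, s.Countable ∧ Submodule.span k s = D) :
      IsSubcoalg (C ⊔ D) ∧ ∃ s : Set X, s.Countable ∧ Submodule.span k s = C ⊔ D := by
    obtain ⟨hC, s, hs, rfl⟩ := hC
    obtain ⟨hD, t, ht, rfl⟩ := hD
    exact ⟨isSubcoalg_sup hC hD, s ∪ t, hs.union ht, Submodule.span_union s t⟩
  choose C hC hx using cover
  -- The value at `x` is independent of the chosen subcoalgebra: both lifts are compared on the sum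
  -- of the two. Additivity of the glued map then follows by evaluating everything on one common
  -- subcoalgebra.
  have val (x : X) (D : Submodule k X) (hD) (hxD : x ∈ D) :
      g (C x) (hC x) ⟨x, hx x⟩ = g D hD ⟨x, hxD⟩ :=
    (compat (C x) (C x ⊔ D) (hC x) (sup _ _ (hC x) hD) le_sup_left ⟨x, hx x⟩).trans
      (compat D (C x ⊔ D) hD (sup _ _ (hC x) hD) le_sup_right ⟨x, hxD⟩).symm
  let G : X →ₗ[k] CoalgProd k B :=
    { toFun := fun x => g (C x) (hC x) ⟨x, hx x⟩
      map_add' := fun x y => by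
        have hD := sup _ _ (hC x) (hC y)
        have hxD : x ∈ C x ⊔ C y := le_sup_left (a := C x) (hx x)
        have hyD : y ∈ C x ⊔ C y := le_sup_right (a := C x) (hx y)
        rw [val x _ hD hxD, val y _ hD hyD, val (x + y) _ hD (add_mem hxD hyD), ← map_add]
        rfl
      map_smul' := fun c x => by
        rw [val (c • x) _ (hC x) (Submodule.smul_mem _ c (hx x)), RingHom.id_apply, ← map_smul]
        rfl }
  have hG (x : X) : G ∘ₗ (C x).subtype = g (C x) (hC x) :=
    LinearMap.ext fun y => val y (C x) (hC x) y.2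
  have hG' : IsComulHom G := by
    refine ⟨fun x => hg' _ (hC x) _, fun x => ?_⟩
    obtain ⟨t, ht⟩ := (hC x).1 x (hx x)
    rw [← ht, ← map_comp_apply, hG]
    exact hg'' _ (hC x) ⟨x, hx x⟩ t ht
  exact ⟨hG'.toCoalgHom, fun i x => hg _ (hC x) i _⟩

end CoalgProduct


/-- Turns the statement that multiplication is a coalgebra map into multiplicativity of `Δ`. -/
lemma map_mul'_tensorTensorTensorComm {k A : Type*} [CommRing k] [Ring A] [Algebra k A]
    (s t : A ⊗[k] A) :
    TensorProduct.map (LinearMap.mul' k A) (LinearMap.mul' k A)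
      (TensorProduct.AlgebraTensorModule.tensorTensorTensorComm k k k k A A A A (s ⊗ₜ t)) =
      s * t := by
  induction s with
  | zero => simp
  | add x y hx hy => simp only [TensorProduct.add_tmul, map_add, hx, hy, add_mul]
  | tmul x y =>
    induction t with
    | zero => simp
    | add z w hz hw => simp only [TensorProduct.tmul_add, map_add, hz, hw, mul_add]
    | tmul z w => simp

/-! ### Products of bialgebras. -/

section BialgProduct

variable {k : Type u} [Field k] {ι : Type} (B : ι → Type u) [∀ i, Ring (B i)]
  [∀ i, Bialgebra k (B i)]

variable (k) in
/-- The product of the bialgebras `B i`. -/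
def BialgProd : Type u := CoalgProd k B

namespace BialgProd

noncomputable instance : AddCommGroup (BialgProd k B) := inferInstanceAs (AddCommGroup (CoalgProd k B))

noncomputable instance : Module k (BialgProd k B) := inferInstanceAs (Module k (CoalgProd k B))

noncomputable instance : Coalgebra k (BialgProd k B) :=
  inferInstanceAs (Coalgebra k (CoalgProd k B))

variable (k) in
/-- The projections, as coalgebra maps. -/
noncomputable def coalgProj (i : ι) : BialgProd k B →ₗc[k] B i := coalgProdProj k B i

variable {B}

lemma coalgHom_ext {X : Type*} [AddCommGroup X] [Module k X] [Coalgebra k X]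
    {f g : X →ₗc[k] BialgProd k B}
    (h : ∀ i x, coalgProj k B i (f x) = coalgProj k B i (g x)) : f = g :=
  coalgProd_hom_ext B h

/-- The coalgebra map into the product given by its components. -/
noncomputable def coalgLift {X : Type*} [AddCommGroup X] [Module k X] [Coalgebra k X]
    (f : ∀ i, X →ₗc[k] B i) : X →ₗc[k] BialgProd k B :=
  (exists_coalgProd_lift B f).choose

@[simp] lemma coalgProj_coalgLift {X : Type*} [AddCommGroup X] [Module k X] [Coalgebra k X]
    (f : ∀ i, X →ₗc[k] B i) (i : ι) (x : X) : coalgProj k B i (coalgLift f x) = f i x :=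
  (exists_coalgProd_lift B f).choose_spec i x

variable (k B) in
/-- The multiplication of the product. -/
noncomputable def mulHom : BialgProd k B ⊗[k] BialgProd k B →ₗc[k] BialgProd k B :=
  coalgLift fun i => (Bialgebra.mulCoalgHom k (B i)).comp
    (Coalgebra.TensorProduct.map (coalgProj k B i) (coalgProj k B i))

variable (k B) in
/-- The unit of the product. -/
noncomputable def oneHom : k →ₗc[k] BialgProd k B :=
  coalgLift fun i => (Bialgebra.unitBialgHom k (B i) : k →ₗc[k] B i)

noncomputable instance : Mul (BialgProd k B) := ⟨fun x y => mulHom k B (x ⊗ₜ y)⟩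

noncomputable instance : One (BialgProd k B) := ⟨oneHom k B 1⟩

lemma mul_def (x y : BialgProd k B) : x * y = mulHom k B (x ⊗ₜ y) := rfl

lemma one_def : (1 : BialgProd k B) = oneHom k B 1 := rfl

lemma coalgProj_mul (i : ι) (x y : BialgProd k B) :
    coalgProj k B i (x * y) = coalgProj k B i x * coalgProj k B i y := by
  rw [mul_def, mulHom, coalgProj_coalgLift]
  simp

lemma coalgProj_one (i : ι) : coalgProj k B i (1 : BialgProd k B) = 1 := by
  rw [one_def, oneHom, coalgProj_coalgLift]
  exact map_one (Bialgebra.unitBialgHom k (B i))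

lemma coalgProj_oneHom (i : ι) (c : k) : coalgProj k B i (oneHom k B c) = algebraMap k (B i) c := by
  rw [oneHom, coalgProj_coalgLift]
  rfl

/-- Only coalgebra maps into the product, not its elements, are known to be determined by their
components. Associativity is therefore stated as an equality of two coalgebra maps on the triple
tensor product; the unit laws are treated likewise. -/
lemma mul_assoc' (x y z : BialgProd k B) : x * y * z = x * (y * z) := by
  have h : (mulHom k B).comp (Coalgebra.TensorProduct.map (mulHom k B) (CoalgHom.id k _)) =
      ((mulHom k B).comp (Coalgebra.TensorProduct.map (CoalgHom.id k _) (mulHom k B))).comp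
        (Coalgebra.TensorProduct.assoc k k _ _ _).toCoalgHom := by
    refine coalgHom_ext fun i t => ?_
    induction t with
    | zero => simp only [map_zero]
    | add a b ha hb => simp only [map_add, ha, hb]
    | tmul a c =>
      induction a with
      | zero => simp only [TensorProduct.zero_tmul, map_zero]
      | add a b ha hb => simp only [TensorProduct.add_tmul, map_add, ha, hb]
      | tmul a b =>
        change coalgProj k B i (a * b * c) = coalgProj k B i (a * (b * c))
        simp only [coalgProj_mul, mul_assoc]
  exact congr($h ((x ⊗ₜ y) ⊗ₜ z))

lemma one_mul' (x : BialgProd k B) : 1 * x = x := by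
  have h : ((mulHom k B).comp (Coalgebra.TensorProduct.map (oneHom k B) (CoalgHom.id k _))) =
      (Coalgebra.TensorProduct.lid k _).toCoalgHom := by
    refine coalgHom_ext fun i t => ?_
    induction t with
    | zero => simp only [map_zero]
    | add a b ha hb => simp only [map_add, ha, hb]
    | tmul c a =>
      change coalgProj k B i (oneHom k B c * a) = coalgProj k B i (c • a)
      rw [coalgProj_mul, coalgProj_oneHom, map_smul, Algebra.smul_def]
  exact congr($h (1 ⊗ₜ x)).trans (one_smul k x)

lemma mul_one' (x : BialgProd k B) : x * 1 = x := by
  have h : ((mulHom k B).comp (Coalgebra.TensorProduct.map (CoalgHom.id k _) (oneHom k B))) =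
      (Coalgebra.TensorProduct.rid k k _).toCoalgHom := by
    refine coalgHom_ext fun i t => ?_
    induction t with
    | zero => simp only [map_zero]
    | add a b ha hb => simp only [map_add, ha, hb]
    | tmul a c =>
      change coalgProj k B i (a * oneHom k B c) = coalgProj k B i (c • a)
      rw [coalgProj_mul, coalgProj_oneHom, map_smul, Algebra.smul_def, Algebra.commutes]
  exact congr($h (x ⊗ₜ 1)).trans (one_smul k x)

noncomputable instance : Ring (BialgProd k B) where
  __ := (inferInstance : AddCommGroup (BialgProd k B))
  mul_assoc := mul_assoc'
  one_mul := one_mul'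
  mul_one := mul_one'
  left_distrib x y z := by simp only [mul_def, TensorProduct.tmul_add, map_add]
  right_distrib x y z := by simp only [mul_def, TensorProduct.add_tmul, map_add]
  zero_mul x := by simp only [mul_def, TensorProduct.zero_tmul, map_zero]
  mul_zero x := by simp only [mul_def, TensorProduct.tmul_zero, map_zero]

noncomputable instance : Algebra k (BialgProd k B) :=
  Algebra.ofModule
    (fun c x y => by simp only [mul_def, ← TensorProduct.smul_tmul', map_smul])
    (fun c x y => by simp only [mul_def, TensorProduct.tmul_smul, map_smul])

noncomputable instance : Bialgebra k (BialgProd k B) :=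
  Bialgebra.mk' k (BialgProd k B)
    (by
      change Coalgebra.counit (R := k) (oneHom k B 1) = 1
      rw [CoalgHomClass.counit_comp_apply]; rfl)
    (by
      intro a b
      change Coalgebra.counit (R := k) (mulHom k B (a ⊗ₜ b)) = _
      rw [CoalgHomClass.counit_comp_apply, TensorProduct.counit_tmul, smul_eq_mul, mul_comm])
    (by
      change Coalgebra.comul (R := k) (oneHom k B 1) = _
      rw [← CoalgHomClass.map_comp_comul_apply]
      rfl)
    (by
      intro a b
      change Coalgebra.comul (R := k) (mulHom k B (a ⊗ₜ b)) = _
      rw [← CoalgHomClass.map_comp_comul_apply, TensorProduct.comul_tmul]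
      have hm : (mulHom k B : BialgProd k B ⊗[k] BialgProd k B →ₗ[k] BialgProd k B) =
          LinearMap.mul' k (BialgProd k B) := TensorProduct.ext' fun _ _ => rfl
      rw [hm]
      exact map_mul'_tensorTensorTensorComm (k := k) (A := BialgProd k B) _ _)

variable (k B) in
/-- The projections, as bialgebra maps. -/
noncomputable def proj (i : ι) : BialgProd k B →ₐc[k] B i :=
  toBialgHom (coalgProj k B i).toLinearMap ⟨coalgProj_one i, coalgProj_mul i⟩
    (isComulHom_coalgHom (coalgProj k B i))

lemma hom_ext {X : Type*} [Ring X] [Bialgebra k X] {f g : X →ₐc[k] BialgProd k B}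
    (h : ∀ i x, proj k B i (f x) = proj k B i (g x)) : f = g := by
  have := coalgHom_ext (B := B) (f := (f : X →ₗc[k] BialgProd k B)) (g := g) h
  ext x
  exact congr($this x)

lemma exists_lift {X : Type*} [Ring X] [Bialgebra k X] (f : ∀ i, X →ₐc[k] B i) :
    ∃ g : X →ₐc[k] BialgProd k B, ∀ i x, proj k B i (g x) = f i x := by
  let g : X →ₗc[k] BialgProd k B := coalgLift fun i => (f i : X →ₗc[k] B i)
  have hg (i : ι) (x : X) : coalgProj k B i (g x) = f i x := coalgProj_coalgLift _ i x
  -- Multiplicativity too is an equality of coalgebra maps, here out of `X ⊗ X`, so it can be tested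
  -- on components.
  have h : g.comp (Bialgebra.mulCoalgHom k X) =
      (mulHom k B).comp (Coalgebra.TensorProduct.map g g) := by
    refine coalgHom_ext fun i t => ?_
    induction t with
    | zero => simp only [map_zero]
    | add a b ha hb => simp only [map_add, ha, hb]
    | tmul a b =>
      change coalgProj k B i (g (a * b)) = coalgProj k B i (g a * g b)
      rw [coalgProj_mul, hg, hg, hg, map_mul]
  have h' : g.comp (Bialgebra.unitBialgHom k X : k →ₗc[k] X) = oneHom k B := by
    refine coalgHom_ext fun i c => ?_
    rw [coalgProj_oneHom]
    exact (hg i _).trans ((f i : X →ₐ[k] B i).commutes c)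
  refine ⟨toBialgHom g.toLinearMap ⟨?_, fun x y => ?_⟩ (isComulHom_coalgHom g), hg⟩
  · refine (congrArg g ?_).trans congr($h' 1)
    exact (map_one (Bialgebra.unitBialgHom k X)).symm
  · exact congr($h (x ⊗ₜ y))

end BialgProd

end BialgProduct

/-- The category of bialgebras has products of countable families. -/
lemma hasProduct_bialgCat {k : Type u} [Field k] {ι : Type} (B : ι → BialgCat.{u} k) :
    HasProduct B := by
  refine ⟨⟨⟨Fan.mk (BialgCat.of k (BialgProd k fun i => B i))
    fun i => ⟨BialgProd.proj k (fun i => B i) i⟩, ?_⟩⟩⟩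
  refine Fan.IsLimit.mk _
    (fun s => ⟨(BialgProd.exists_lift fun i => (s.proj i).toBialgHom).choose⟩) ?_ ?_
  · intro s i
    refine BialgCat.hom_ext _ _ (BialgHom.ext fun x => ?_)
    exact (BialgProd.exists_lift fun i => (s.proj i).toBialgHom).choose_spec i x
  · intro s m hm
    refine BialgCat.hom_ext _ _ (BialgProd.hom_ext fun i x => ?_)
    refine .trans ?_
      ((BialgProd.exists_lift fun i => (s.proj i).toBialgHom).choose_spec i x).symm
    exact congr(($(hm i)).toBialgHom x)


/-! ### The subspace on which an antimultiplicative map satisfies the antipode identities. -/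

section AntipodalSpace

variable {k : Type*} [CommRing k] {P : Type*} [Ring P] [Bialgebra k P]

/-- The elements `x` with `x₍₁₎ S(x₍₂₎) = ε(x) 1 = S(x₍₁₎) x₍₂₎`. -/
def antipodalSpace (S : P →ₗ[k] P) : Submodule k P :=
  LinearMap.eqLocus (LinearMap.mul' k P ∘ₗ S.lTensor P ∘ₗ Coalgebra.comul)
      (Algebra.linearMap k P ∘ₗ Coalgebra.counit) ⊓
    LinearMap.eqLocus (LinearMap.mul' k P ∘ₗ S.rTensor P ∘ₗ Coalgebra.comul)
      (Algebra.linearMap k P ∘ₗ Coalgebra.counit)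

lemma mem_antipodalSpace {S : P →ₗ[k] P} {x : P} : x ∈ antipodalSpace S ↔
    LinearMap.mul' k P (S.lTensor P (Coalgebra.comul (R := k) x)) =
        algebraMap k P (Coalgebra.counit (R := k) x) ∧
      LinearMap.mul' k P (S.rTensor P (Coalgebra.comul (R := k) x)) =
        algebraMap k P (Coalgebra.counit (R := k) x) :=
  Iff.rfl

variable {S : P →ₗ[k] P} (hS : IsAntiMulHom S)

include hS

/-- As `S` reverses products, `a c S(b d) = a (c S(d)) S(b)`: the contribution of `u` sits in the
middle, where it collapses to a scalar. -/
lemma mul'_lTensor_mul {u : P ⊗[k] P} {c : k}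
    (hu : LinearMap.mul' k P (S.lTensor P u) = algebraMap k P c) (t : P ⊗[k] P) :
    LinearMap.mul' k P (S.lTensor P (t * u)) = LinearMap.mul' k P (S.lTensor P t) *
      algebraMap k P c := by
  induction t with
  | zero => simp
  | add x y hx hy => simp only [add_mul, map_add, hx, hy]
  | tmul a b =>
    have key (v : P ⊗[k] P) : LinearMap.mul' k P (S.lTensor P (a ⊗ₜ b * v)) =
        a * LinearMap.mul' k P (S.lTensor P v) * S b := by
      induction v with
      | zero => simp
      | add x y hx hy => simp only [mul_add, add_mul, map_add, hx, hy]
      | tmul c d => simp [hS.map_mul, mul_assoc]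
    rw [key, hu, mul_assoc, Algebra.commutes, ← mul_assoc]
    simp

lemma mul'_rTensor_mul {t : P ⊗[k] P} {c : k}
    (ht : LinearMap.mul' k P (S.rTensor P t) = algebraMap k P c) (u : P ⊗[k] P) :
    LinearMap.mul' k P (S.rTensor P (t * u)) = algebraMap k P c *
      LinearMap.mul' k P (S.rTensor P u) := by
  induction u with
  | zero => simp
  | add x y hx hy => simp only [mul_add, map_add, hx, hy]
  | tmul a b =>
    have key (v : P ⊗[k] P) : LinearMap.mul' k P (S.rTensor P (v * a ⊗ₜ b)) =
        S a * LinearMap.mul' k P (S.rTensor P v) * b := by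
      induction v with
      | zero => simp
      | add x y hx hy => simp only [mul_add, add_mul, map_add, hx, hy]
      | tmul c d => simp [hS.map_mul, mul_assoc]
    rw [key, ht, ← Algebra.commutes, mul_assoc]
    simp

lemma one_mem_antipodalSpace : (1 : P) ∈ antipodalSpace S := by
  rw [mem_antipodalSpace]
  simp [Algebra.TensorProduct.one_def, hS.map_one]

lemma mul_mem_antipodalSpace {x y : P} (hx : x ∈ antipodalSpace S)
    (hy : y ∈ antipodalSpace S) : x * y ∈ antipodalSpace S := by
  rw [mem_antipodalSpace] at hx hy ⊢
  rw [Bialgebra.comul_mul, mul'_lTensor_mul hS hy.1, hx.1, mul'_rTensor_mul hS hx.2, hy.2,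
    Bialgebra.counit_mul, map_mul]
  exact ⟨rfl, rfl⟩

/-- Since `S` reverses both products and coproducts, it carries each of the two identities for `x`
to the other one for `S x`. -/
lemma map_mem_antipodalSpace (hS' : IsAntiComulHom S) {x : P} (hx : x ∈ antipodalSpace S) :
    S x ∈ antipodalSpace S := by
  rw [mem_antipodalSpace] at hx ⊢
  have key₁ (t : P ⊗[k] P) : LinearMap.mul' k P (S.lTensor P
      (TensorProduct.comm k P P (TensorProduct.map S S t))) =
      S (LinearMap.mul' k P (S.rTensor P t)) := by
    induction t with
    | zero => simp
    | add x y hx hy => simp only [map_add, hx, hy]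
    | tmul a b => simp [hS.map_mul]
  have key₂ (t : P ⊗[k] P) : LinearMap.mul' k P (S.rTensor P
      (TensorProduct.comm k P P (TensorProduct.map S S t))) =
      S (LinearMap.mul' k P (S.lTensor P t)) := by
    induction t with
    | zero => simp
    | add x y hx hy => simp only [map_add, hx, hy]
    | tmul a b => simp [hS.map_mul]
  rw [hS'.comul, key₁, key₂, hx.1, hx.2, hS'.counit, hS.map_algebraMap]
  exact ⟨rfl, rfl⟩

end AntipodalSpace

/-! ### Subbialgebras and Hopf subalgebras. -/

section OfInjective

variable {k : Type*} [Field k] {W P : Type*} [Ring W] [Algebra k W] [Ring P] [Bialgebra k P]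
  (i : W →ₐ[k] P) (hi : Function.Injective i)
  (h : ∀ w, Coalgebra.comul (R := k) (i w) ∈
    LinearMap.range (TensorProduct.map i.toLinearMap i.toLinearMap))

/-- A subalgebra whose comultiples stay inside is a bialgebra. -/
noncomputable abbrev bialgebraOfInjective : Bialgebra k W :=
  Bialgebra.mk' (C := coalgebraOfInjective i.toLinearMap hi h) k W
    (by
      change Coalgebra.counit (R := k) (i 1) = 1
      simp)
    (by
      intro a b
      change Coalgebra.counit (R := k) (i (a * b)) =
        Coalgebra.counit (R := k) (i a) * Coalgebra.counit (R := k) (i b)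
      simp)
    (by
      apply map_injective_of_injective (f := i.toLinearMap) (g := i.toLinearMap) hi hi
      refine (map_comulOfInjective i.toLinearMap hi h 1).trans ?_
      simp [Algebra.TensorProduct.one_def])
    (by
      intro a b
      apply map_injective_of_injective (f := i.toLinearMap) (g := i.toLinearMap) hi hi
      refine (map_comulOfInjective i.toLinearMap hi h (a * b)).trans ?_
      refine .trans ?_ (map_mul (Algebra.TensorProduct.map i i) _ _).symm
      refine .trans ?_ (congrArg₂ (· * ·) (map_comulOfInjective i.toLinearMap hi h a)
        (map_comulOfInjective i.toLinearMap hi h b)).symm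
      simp)

variable {S : P →ₗ[k] P} (hS : ∀ w, S (i w) ∈ LinearMap.range i.toLinearMap)

/-- The restriction of `S` to a subalgebra. -/
noncomputable def antipodeOfInjective : W →ₗ[k] W :=
  (LinearEquiv.ofInjective i.toLinearMap hi).symm.toLinearMap ∘ₗ
    (S ∘ₗ i.toLinearMap).codRestrict _ hS

lemma map_antipodeOfInjective (w : W) : i (antipodeOfInjective i hi hS w) = S (i w) :=
  congrArg Subtype.val ((LinearEquiv.ofInjective i.toLinearMap hi).apply_symm_apply
    ((S ∘ₗ i.toLinearMap).codRestrict _ hS w))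

/-- A subbialgebra on which a linear endomorphism acts as an antipode is a Hopf algebra. -/
noncomputable abbrev hopfAlgebraOfInjective (hS' : ∀ w, i w ∈ antipodalSpace S) :
    HopfAlgebra k W :=
  letI : Bialgebra k W := bialgebraOfInjective i hi h
  { antipode := antipodeOfInjective i hi hS
    mul_antipode_rTensor_comul := by
      have key (t : W ⊗[k] W) : i (LinearMap.mul' k W
          (LinearMap.rTensor W (antipodeOfInjective i hi hS) t)) =
          LinearMap.mul' k P (S.rTensor P
            (TensorProduct.map i.toLinearMap i.toLinearMap t)) := by
        induction t with
        | zero => simp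
        | add x y hx hy => simp only [map_add, hx, hy]
        | tmul a b => simp [map_antipodeOfInjective]
      ext w
      apply hi
      refine (key _).trans ?_
      refine (congrArg (fun t => LinearMap.mul' k P (S.rTensor P t))
        (map_comulOfInjective i.toLinearMap hi h w)).trans ?_
      exact (mem_antipodalSpace.1 (hS' w)).2.trans (i.commutes _).symm
    mul_antipode_lTensor_comul := by
      have key (t : W ⊗[k] W) : i (LinearMap.mul' k W
          (LinearMap.lTensor W (antipodeOfInjective i hi hS) t)) =
          LinearMap.mul' k P (S.lTensor P
            (TensorProduct.map i.toLinearMap i.toLinearMap t)) := by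
        induction t with
        | zero => simp
        | add x y hx hy => simp only [map_add, hx, hy]
        | tmul a b => simp [map_antipodeOfInjective]
      ext w
      apply hi
      refine (key _).trans ?_
      refine (congrArg (fun t => LinearMap.mul' k P (S.lTensor P t))
        (map_comulOfInjective i.toLinearMap hi h w)).trans ?_
      exact (mem_antipodalSpace.1 (hS' w)).1.trans (i.commutes _).symm }

end OfInjective

/-! ### The alternating sequence and the shift. -/

section Bundled

variable {k : Type u} [Field k]

lemma isAntiMulHom_opCopEquiv (B : BialgCat.{u} k) :
    IsAntiMulHom (opCopEquiv B).toLinearMap := ⟨rfl, fun _ _ => rfl⟩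

lemma isAntiComulHom_opCopEquiv (B : BialgCat.{u} k) :
    IsAntiComulHom (opCopEquiv B).toLinearMap := ⟨fun _ => rfl, opCop_comul B⟩

lemma bijective_alternatingId (B : BialgCat.{u} k) :
    ∀ n, Function.Bijective (alternatingId B n).toBialgHom
  | 0 => (opCopEquiv (opCop B)).symm.trans (opCopEquiv B).symm |>.bijective
  | 1 => Function.bijective_id
  | n + 2 => bijective_alternatingId B n

/-- The identity map `B_{n+1} → B_n`, as a linear isomorphism. -/
noncomputable def twist (B : BialgCat.{u} k) (n : ℕ) :
    alternating B (n + 1) ≃ₗ[k] alternating B n :=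
  (opCopEquiv (alternating B (n + 1))).trans
    (LinearEquiv.ofBijective
      ((alternatingId B n).toBialgHom : opCop (alternating B (n + 1)) →ₗ[k] alternating B n)
      (bijective_alternatingId B n))

lemma twist_eq (B : BialgCat.{u} k) (n : ℕ) : (twist B n).toLinearMap =
    ((alternatingId B n).toBialgHom : opCop (alternating B (n + 1)) →ₗ[k] alternating B n) ∘ₗ
      (opCopEquiv (alternating B (n + 1))).toLinearMap := rfl

lemma isAntiMulHom_twist (B : BialgCat.{u} k) (n : ℕ) :
    IsAntiMulHom (twist B n).toLinearMap := by
  rw [twist_eq]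
  exact (isMulHom_bialgHom _).comp_anti (isAntiMulHom_opCopEquiv _)

lemma isAntiComulHom_twist (B : BialgCat.{u} k) (n : ℕ) :
    IsAntiComulHom (twist B n).toLinearMap := by
  rw [twist_eq]
  exact (isComulHom_bialgHom _).comp_anti (isAntiComulHom_opCopEquiv _)

variable {B : BialgCat.{u} k} {c : Fan (alternating B)} (hc : IsLimit c)

lemma isAntiMulHom_shiftLin : IsAntiMulHom (shiftLin hc) :=
  (isMulHom_bialgHom _).comp_anti (isAntiMulHom_opCopEquiv _)

lemma isAntiComulHom_shiftLin : IsAntiComulHom (shiftLin hc) :=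
  (isComulHom_bialgHom _).comp_anti (isAntiComulHom_opCopEquiv _)

lemma proj_shiftLin (n : ℕ) (x : c.pt) :
    (c.proj n).toBialgHom (shiftLin hc x) = twist B n ((c.proj (n + 1)).toBialgHom x) := by
  have h := Fan.IsLimit.fac hc (fun n => opCopMap (c.proj (n + 1)) ≫ alternatingId B n) n
  exact congr(($h).toBialgHom (opCopEquiv c.pt x))

include hc in
/-- Bialgebra maps into a product are determined by their components. -/
lemma bialgHom_ext_of_isLimit {X : Type u} [Ring X] [Bialgebra k X] {f g : X →ₐc[k] c.pt}
    (h : ∀ n x, (c.proj n).toBialgHom (f x) = (c.proj n).toBialgHom (g x)) : f = g := by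
  have := Fan.IsLimit.hom_ext hc (⟨f⟩ : BialgCat.of k X ⟶ c.pt) ⟨g⟩
    fun n => BialgCat.hom_ext _ _ (BialgHom.ext fun x => h n x)
  exact congr(($this).toBialgHom)

include hc in
lemma exists_lift_of_isLimit {X : Type u} [Ring X] [Bialgebra k X]
    (f : ∀ n, X →ₐc[k] alternating B n) :
    ∃ g : X →ₐc[k] c.pt, ∀ n x, (c.proj n).toBialgHom (g x) = f n x := by
  refine ⟨(Fan.IsLimit.lift hc fun n =>
    (⟨f n⟩ : BialgCat.of k X ⟶ alternating B n)).toBialgHom, fun n x => ?_⟩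
  have := Fan.IsLimit.fac hc (fun n => (⟨f n⟩ : BialgCat.of k X ⟶ alternating B n)) n
  exact congr(($this).toBialgHom x)

include hc in
-- Maps reversing both structures are bialgebra maps out of `X^{op,cop}`, so uniqueness of maps into
-- the product applies to them.
lemma anti_ext_of_isLimit {X : Type u} [Ring X] [Bialgebra k X] {f g : X →ₗ[k] c.pt}
    (hf : IsAntiMulHom f) (hf' : IsAntiComulHom f) (hg : IsAntiMulHom g) (hg' : IsAntiComulHom g)
    (h : ∀ n x, (c.proj n).toBialgHom (f x) = (c.proj n).toBialgHom (g x)) : f = g := by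
  let e := opCopEquiv (BialgCat.of k X)
  have he : IsAntiMulHom e.symm.toLinearMap := (isAntiMulHom_opCopEquiv _).symm
  have he' : IsAntiComulHom e.symm.toLinearMap := (isAntiComulHom_opCopEquiv _).symm
  have := bialgHom_ext_of_isLimit hc
    (f := toBialgHom (f ∘ₗ e.symm.toLinearMap) (hf.comp_anti he) (hf'.comp_anti he'))
    (g := toBialgHom (g ∘ₗ e.symm.toLinearMap) (hg.comp_anti he) (hg'.comp_anti he'))
    fun n x => h n _
  ext x
  exact congr($this (e x))

end Bundled

/-! ### The cofree Hopf algebra on a bialgebra. -/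

section AntipodalPart

variable {k : Type u} [Field k] {B : BialgCat.{u} k} {c : Fan (alternating B)} (hc : IsLimit c)

lemma actsAsAntipode_iff {P : Type u} [Ring P] [Bialgebra k P] {S : P →ₗ[k] P}
    {C : Submodule k P} : ActsAsAntipode P S C ↔ C ≤ antipodalSpace S := Iff.rfl

/-- The sum of the antipodal subcoalgebras is the largest one. -/
lemma isGreatest_antipodalPart : IsGreatest (antipodalSubcoalgebras hc) (antipodalPart hc) :=
  ⟨⟨isSubcoalg_sSup fun _ hC => hC.1,
    actsAsAntipode_iff.2 (sSup_le fun _ hC => actsAsAntipode_iff.1 hC.2)⟩, fun _ => le_sSup⟩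

lemma isSubcoalg_antipodalPart : IsSubcoalg (antipodalPart hc) :=
  (isGreatest_antipodalPart hc).1.1

lemma antipodalPart_le : antipodalPart hc ≤ antipodalSpace (shiftLin hc) :=
  (isGreatest_antipodalPart hc).1.2

lemma le_antipodalPart {C : Submodule k c.pt} (hC : IsSubcoalg C)
    (hC' : C ≤ antipodalSpace (shiftLin hc)) : C ≤ antipodalPart hc :=
  (isGreatest_antipodalPart hc).2 ⟨hC, hC'⟩

lemma isSubcoalg_span_one {P : Type*} [Ring P] [Bialgebra k P] :
    IsSubcoalg (Submodule.span k {(1 : P)}) := by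
  intro x hx
  obtain ⟨a, rfl⟩ := Submodule.mem_span_singleton.1 hx
  rw [map_smul, Bialgebra.comul_one]
  exact Submodule.smul_mem _ _ ⟨⟨1, Submodule.mem_span_singleton_self 1⟩ ⊗ₜ
    ⟨1, Submodule.mem_span_singleton_self 1⟩, rfl⟩

lemma isSubcoalg_mul {P : Type*} [Ring P] [Bialgebra k P] {C D : Submodule k P}
    (hC : IsSubcoalg C) (hD : IsSubcoalg D) : IsSubcoalg (C * D) := by
  have key (s : C ⊗[k] C) (t : D ⊗[k] D) : TensorProduct.map C.subtype C.subtype s *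
      TensorProduct.map D.subtype D.subtype t ∈
      LinearMap.range (TensorProduct.map (C * D).subtype (C * D).subtype) := by
    induction s with
    | zero => simp
    | add x y hx hy => rw [map_add, add_mul]; exact add_mem hx hy
    | tmul a b =>
      induction t with
      | zero => simp
      | add x y hx hy => rw [map_add, mul_add]; exact add_mem hx hy
      | tmul a' b' =>
        exact ⟨⟨a * a', Submodule.mul_mem_mul a.2 a'.2⟩ ⊗ₜ
          ⟨b * b', Submodule.mul_mem_mul b.2 b'.2⟩, by simp⟩
  have : C * D ≤ (LinearMap.range
      (TensorProduct.map (C * D).subtype (C * D).subtype)).comap Coalgebra.comul := by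
    rw [Submodule.mul_le]
    intro x hx y hy
    obtain ⟨s, hs⟩ := hC x hx
    obtain ⟨t, ht⟩ := hD y hy
    rw [Submodule.mem_comap, Bialgebra.comul_mul, ← hs, ← ht]
    exact key s t
  exact this

lemma isSubcoalg_map_of_comul {X Y : Type*} [AddCommGroup X] [Module k X] [Coalgebra k X]
    [AddCommGroup Y] [Module k Y] [Coalgebra k Y] {f : X →ₗ[k] Y} (hf : IsComulHom f) :
    IsSubcoalg (LinearMap.range f) := by
  rintro _ ⟨x, rfl⟩
  refine ⟨TensorProduct.map f.rangeRestrict f.rangeRestrict (Coalgebra.comul (R := k) x), ?_⟩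
  rw [← map_comp_apply, hf.comul]
  rfl

lemma isSubcoalg_map_of_antiComul {X Y : Type*} [AddCommGroup X] [Module k X] [Coalgebra k X]
    [AddCommGroup Y] [Module k Y] [Coalgebra k Y] {f : X →ₗ[k] Y} (hf : IsAntiComulHom f)
    {C : Submodule k X} (hC : IsSubcoalg C) : IsSubcoalg (C.map f) := by
  rintro _ ⟨x, hx, rfl⟩
  obtain ⟨t, ht⟩ := hC x hx
  refine ⟨TensorProduct.comm k _ _
    (TensorProduct.map (f.submoduleMap C) (f.submoduleMap C) t), ?_⟩
  rw [TensorProduct.map_comm, ← map_comp_apply, hf.comul, ← ht, ← map_comp_apply]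
  rfl

/-- The antipodal part as a subalgebra. -/
noncomputable def antipodalSubalgebra : Subalgebra k c.pt :=
  (antipodalPart hc).toSubalgebra
    (le_antipodalPart hc isSubcoalg_span_one (by
      rw [Submodule.span_le, Set.singleton_subset_iff]
      exact one_mem_antipodalSpace (isAntiMulHom_shiftLin hc))
      (Submodule.mem_span_singleton_self 1))
    (fun x y hx hy => le_antipodalPart hc
      (isSubcoalg_mul (isSubcoalg_antipodalPart hc) (isSubcoalg_antipodalPart hc)) (by
        rw [Submodule.mul_le]
        exact fun x hx y hy => mul_mem_antipodalSpace (isAntiMulHom_shiftLin hc)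
          (antipodalPart_le hc hx) (antipodalPart_le hc hy))
      (Submodule.mul_mem_mul hx hy))

lemma shiftLin_mem_antipodalPart {x : c.pt} (hx : x ∈ antipodalPart hc) :
    shiftLin hc x ∈ antipodalPart hc := by
  refine le_antipodalPart hc (isSubcoalg_map_of_antiComul (isAntiComulHom_shiftLin hc)
    (isSubcoalg_antipodalPart hc)) ?_ (Submodule.mem_map_of_mem hx)
  rintro _ ⟨y, hy, rfl⟩
  exact map_mem_antipodalSpace (isAntiMulHom_shiftLin hc) (isAntiComulHom_shiftLin hc)
    (antipodalPart_le hc hy)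

/-- The carrier of the Hopf algebra cofreely generated by `B`. -/
def CofreeHopf (hc : IsLimit c) : Type u := antipodalSubalgebra hc

namespace CofreeHopf

noncomputable instance : Ring (CofreeHopf hc) := inferInstanceAs (Ring (antipodalSubalgebra hc))

noncomputable instance : Algebra k (CofreeHopf hc) :=
  inferInstanceAs (Algebra k (antipodalSubalgebra hc))

/-- The inclusion into the product, as an algebra map. -/
noncomputable def algIncl : CofreeHopf hc →ₐ[k] c.pt := (antipodalSubalgebra hc).val

lemma algIncl_injective : Function.Injective (algIncl hc) := Subtype.val_injective

lemma algIncl_mem (x : CofreeHopf hc) : algIncl hc x ∈ antipodalPart hc := x.2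

lemma exists_algIncl_eq {x : c.pt} (hx : x ∈ antipodalPart hc) : ∃ y, algIncl hc y = x :=
  ⟨⟨x, hx⟩, rfl⟩

lemma comul_algIncl_mem (x : CofreeHopf hc) : Coalgebra.comul (R := k) (algIncl hc x) ∈
    LinearMap.range (TensorProduct.map (algIncl hc).toLinearMap (algIncl hc).toLinearMap) := by
  obtain ⟨t, ht⟩ := isSubcoalg_antipodalPart hc _ (algIncl_mem hc x)
  let j : antipodalPart hc →ₗ[k] CofreeHopf hc := { toFun := id, map_add' := fun _ _ => rfl,
                                                    map_smul' := fun _ _ => rfl }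
  refine ⟨TensorProduct.map j j t, ?_⟩
  rw [← ht, ← map_comp_apply]
  rfl

noncomputable instance : HopfAlgebra k (CofreeHopf hc) :=
  hopfAlgebraOfInjective (algIncl hc) (algIncl_injective hc) (comul_algIncl_mem hc)
    (S := shiftLin hc)
    (fun x => exists_algIncl_eq hc (shiftLin_mem_antipodalPart hc (algIncl_mem hc x)))
    (fun x => antipodalPart_le hc (algIncl_mem hc x))

/-- The inclusion into the product. -/
noncomputable def incl : CofreeHopf hc →ₐc[k] c.pt :=
  toBialgHom (algIncl hc).toLinearMap (isMulHom_algHom _)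
    (isComulHom_ofInjective (algIncl hc).toLinearMap (algIncl_injective hc)
      (comul_algIncl_mem hc))

lemma incl_injective : Function.Injective (incl hc) := algIncl_injective hc

lemma range_incl : LinearMap.range (incl hc : CofreeHopf hc →ₗ[k] c.pt) = antipodalPart hc := by
  ext x
  constructor
  · rintro ⟨y, rfl⟩
    exact algIncl_mem hc y
  · exact exists_algIncl_eq hc

lemma incl_antipode (x : CofreeHopf hc) :
    incl hc (HopfAlgebra.antipode k x) = shiftLin hc (incl hc x) :=
  map_antipodeOfInjective (algIncl hc) (algIncl_injective hc) _ x

/-- The counit of the adjunction. -/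
noncomputable def counit : CofreeHopf hc →ₐc[k] B :=
  ((c.proj 0).toBialgHom : c.pt →ₐc[k] B).comp (incl hc)

variable {hc} in
-- Because `f` commutes with antipodes and the antipode is the shift, the component of `f` in degree
-- `n + 1` at `x` is the one in degree `n` at `S x`. Agreement in degree `0` thus propagates to all
-- degrees.
lemma hom_ext {X : Type u} [Ring X] [HopfAlgebra k X] {f g : X →ₐc[k] CofreeHopf hc}
    (h : ∀ x, counit hc (f x) = counit hc (g x)) : f = g := by
  have key (f : X →ₐc[k] CofreeHopf hc) (n : ℕ) (x : X) :
      twist B n ((c.proj (n + 1)).toBialgHom (incl hc (f x))) =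
        (c.proj n).toBialgHom (incl hc (f (HopfAlgebra.antipode k x))) := by
    rw [← proj_shiftLin hc, ← incl_antipode, antipode_bialgHom_apply]
  have h' (n : ℕ) : ∀ x, (c.proj n).toBialgHom (incl hc (f x)) =
      (c.proj n).toBialgHom (incl hc (g x)) := by
    induction n with
    | zero => exact h
    | succ n ih => exact fun x => (twist B n).injective ((key f n x).trans
        ((ih _).trans (key g n x).symm))
  have := bialgHom_ext_of_isLimit hc (f := (incl hc).comp f) (g := (incl hc).comp g) h'
  ext x
  exact incl_injective hc congr($this x)

/-- The maps `f ∘ S^n : X → B_n`. -/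
noncomputable def component {X : Type u} [Ring X] [HopfAlgebra k X] (f : X →ₐc[k] B) :
    (n : ℕ) → X →ₐc[k] alternating B n
  | 0 => f
  | n + 1 => toBialgHom ((twist B n).symm.toLinearMap ∘ₗ
      (component f n : X →ₗ[k] alternating B n) ∘ₗ HopfAlgebra.antipode k)
      ((isAntiMulHom_twist B n).symm.comp_anti
        ((isMulHom_bialgHom _).comp_anti isAntiMulHom_antipode))
      ((isAntiComulHom_twist B n).symm.comp_anti
        ((isComulHom_bialgHom _).comp_anti isAntiComulHom_antipode))

lemma twist_component {X : Type u} [Ring X] [HopfAlgebra k X] (f : X →ₐc[k] B) (n : ℕ) (x : X) :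
    twist B n (component f (n + 1) x) = component f n (HopfAlgebra.antipode k x) :=
  (twist B n).apply_symm_apply _

lemma exists_lift {X : Type u} [Ring X] [HopfAlgebra k X] (f : X →ₐc[k] B) :
    ∃ g : X →ₐc[k] CofreeHopf hc, ∀ x, counit hc (g x) = f x := by
  obtain ⟨F, hF⟩ := exists_lift_of_isLimit hc (component f)
  -- Both sides reverse products and coproducts, and in degree `n` both have the component `f ∘
  -- S^(n+1)`, up to the identifications of the `B_n` with `B`.
  have hFS : shiftLin hc ∘ₗ (F : X →ₗ[k] c.pt) = (F : X →ₗ[k] c.pt) ∘ₗ HopfAlgebra.antipode k :=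
    anti_ext_of_isLimit hc
      ((isAntiMulHom_shiftLin hc).comp (isMulHom_bialgHom F))
      ((isAntiComulHom_shiftLin hc).comp (isComulHom_bialgHom F))
      ((isMulHom_bialgHom F).comp_anti isAntiMulHom_antipode)
      ((isComulHom_bialgHom F).comp_anti isAntiComulHom_antipode) fun n x => by
        refine (proj_shiftLin hc n (F x)).trans ?_
        rw [hF]
        exact (twist_component f n x).trans (hF n _).symm
  have hle : LinearMap.range (F : X →ₗ[k] c.pt) ≤ antipodalPart hc := by
    refine le_antipodalPart hc (isSubcoalg_map_of_comul (isComulHom_bialgHom F)) ?_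
    rintro _ ⟨x, rfl⟩
    -- `F ∘ S` is the convolution inverse of `F`; rewritten as `shift ∘ F`, this is the antipode
    -- identity on the image of `F`.
    have h := (convInverse_antipode (k := k) (H := X)).mulHom_comp (isMulHom_bialgHom F)
    rw [← hFS] at h
    rw [mem_antipodalSpace, (isComulHom_bialgHom F).comul, (isComulHom_bialgHom F).counit,
      LinearMap.lTensor, LinearMap.rTensor, ← map_comp_apply, ← map_comp_apply]
    exact ⟨h.left x, h.right x⟩
  choose g hg using fun x => exists_algIncl_eq hc (hle ⟨x, rfl⟩)
  let G : X →ₗ[k] CofreeHopf hc :=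
    { toFun := g
      map_add' := fun x y => algIncl_injective hc (by simp only [hg, map_add])
      map_smul' := fun a x => algIncl_injective hc (by simp only [hg, map_smul, RingHom.id_apply]) }
  have hG : (incl hc : CofreeHopf hc →ₗ[k] c.pt) ∘ₗ G = F := LinearMap.ext hg
  have hGm : IsMulHom G :=
    ⟨algIncl_injective hc ((hg 1).trans (by simp)), fun x y => algIncl_injective hc
      (((hg (x * y)).trans (map_mul F x y)).trans
        ((congrArg₂ HMul.hMul (hg x).symm (hg y).symm).trans
          (map_mul (algIncl hc) (g x) (g y)).symm))⟩
  have hGc : IsComulHom G := by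
    constructor
    · intro x
      rw [← (isComulHom_bialgHom (incl hc)).counit, ← (isComulHom_bialgHom F).counit, ← hG]
      rfl
    · intro x
      apply map_injective_of_injective (f := (incl hc : CofreeHopf hc →ₗ[k] c.pt))
        (g := (incl hc : CofreeHopf hc →ₗ[k] c.pt)) (incl_injective hc) (incl_injective hc)
      rw [← (isComulHom_bialgHom (incl hc)).comul, ← map_comp_apply, hG,
        ← (isComulHom_bialgHom F).comul, ← hG]
      rfl
  exact ⟨toBialgHom G hGm hGc, fun x => (congrArg _ (hg x)).trans (hF 0 x)⟩

end CofreeHopf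

end AntipodalPart


/-! ### The free Hopf algebra on a bialgebra. -/

section FreeHopf

variable {k : Type u} [Field k]

/-- The identity map `B_n → B_{n+1}`. -/
noncomputable def untwist (B : BialgCat.{u} k) (n : ℕ) :
    alternating B n →ₗ[k] alternating B (n + 1) := (twist B n).symm.toLinearMap

lemma isAntiMulHom_untwist (B : BialgCat.{u} k) (n : ℕ) : IsAntiMulHom (untwist B n) :=
  (isAntiMulHom_twist B n).symm

lemma isAntiComulHom_untwist (B : BialgCat.{u} k) (n : ℕ) : IsAntiComulHom (untwist B n) :=
  (isAntiComulHom_twist B n).symm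

lemma untwist_surjective (B : BialgCat.{u} k) (n : ℕ) : Function.Surjective (untwist B n) :=
  (twist B n).symm.surjective

/-- The generators `⨁ B_n` of the free Hopf algebra. -/
abbrev Generators (B : BialgCat.{u} k) : Type u := Π₀ n, alternating B n

/-- The generators in degree `n`. -/
noncomputable def generator (B : BialgCat.{u} k) (n : ℕ) :
    alternating B n →ₗ[k] TensorAlgebra k (Generators B) :=
  TensorAlgebra.ι k ∘ₗ DFinsupp.lsingle (M := fun n => (alternating B n : Type u)) n

/-- The relations making the inclusions of the `B_n` multiplicative and consecutive inclusions
convolution inverse to each other. -/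
inductive FreeHopfRel (B : BialgCat.{u} k) : TensorAlgebra k (Generators B) →
    TensorAlgebra k (Generators B) → Prop
  | one (n : ℕ) : FreeHopfRel B (generator B n 1) 1
  | mul (n : ℕ) (a b : alternating B n) :
    FreeHopfRel B (generator B n (a * b)) (generator B n a * generator B n b)
  | left (n : ℕ) (a : alternating B n) :
    FreeHopfRel B (LinearMap.mul' k _ (TensorProduct.map (generator B n)
      (generator B (n + 1) ∘ₗ untwist B n) (Coalgebra.comul (R := k) a)))
      (algebraMap k _ (Coalgebra.counit (R := k) a))
  | right (n : ℕ) (a : alternating B n) :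
    FreeHopfRel B (LinearMap.mul' k _ (TensorProduct.map (generator B (n + 1) ∘ₗ untwist B n)
      (generator B n) (Coalgebra.comul (R := k) a)))
      (algebraMap k _ (Coalgebra.counit (R := k) a))

/-- The Hopf algebra freely generated by the bialgebra `B`. -/
def FreeHopf (B : BialgCat.{u} k) : Type u := RingQuot (FreeHopfRel B)

namespace FreeHopf

variable (B : BialgCat.{u} k)

noncomputable instance : Ring (FreeHopf B) := inferInstanceAs (Ring (RingQuot (FreeHopfRel B)))

noncomputable instance : Algebra k (FreeHopf B) :=
  inferInstanceAs (Algebra k (RingQuot (FreeHopfRel B)))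

/-- The quotient map. -/
noncomputable def mk : TensorAlgebra k (Generators B) →ₐ[k] FreeHopf B :=
  RingQuot.mkAlgHom k (FreeHopfRel B)

lemma mk_surjective : Function.Surjective (mk B) := RingQuot.mkAlgHom_surjective k _

lemma mk_rel {x y : TensorAlgebra k (Generators B)} (h : FreeHopfRel B x y) : mk B x = mk B y :=
  RingQuot.mkAlgHom_rel k h

/-- The inclusion of `B_n`. -/
noncomputable def inc (n : ℕ) : alternating B n →ₗ[k] FreeHopf B :=
  (mk B).toLinearMap ∘ₗ generator B n

lemma isMulHom_inc (n : ℕ) : IsMulHom (inc B n) :=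
  ⟨(mk_rel B (.one n)).trans (map_one _), fun a b => (mk_rel B (.mul n a b)).trans (map_mul _ _ _)⟩

lemma convInverse_inc (n : ℕ) : ConvInverse (inc B n) (inc B (n + 1) ∘ₗ untwist B n) := by
  have key := mul'_map_comp (C := alternating B n) (mk B).toLinearMap (isMulHom_algHom (mk B))
  constructor <;> intro a
  · have h := key (generator B n) (generator B (n + 1) ∘ₗ untwist B n)
      (Coalgebra.comul (R := k) a)
    rw [← LinearMap.comp_assoc] at h
    exact h.trans ((mk_rel B (.left n a)).trans ((mk B).commutes _))
  · have h := key (generator B (n + 1) ∘ₗ untwist B n) (generator B n)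
      (Coalgebra.comul (R := k) a)
    rw [← LinearMap.comp_assoc] at h
    exact h.trans ((mk_rel B (.right n a)).trans ((mk B).commutes _))

variable {B}

section Lift

variable {C : Type*} [Ring C] [Algebra k C]

/-- The universal property of the free Hopf algebra as an algebra. -/
noncomputable def algLift (f : ∀ n, alternating B n →ₗ[k] C) (hf : ∀ n, IsMulHom (f n))
    (hf' : ∀ n, ConvInverse (f n) (f (n + 1) ∘ₗ untwist B n)) : FreeHopf B →ₐ[k] C :=
  RingQuot.liftAlgHom k ⟨TensorAlgebra.lift k (DFinsupp.lsum k f), by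
    have hg (n : ℕ) : (TensorAlgebra.lift k (DFinsupp.lsum k f)).toLinearMap ∘ₗ generator B n =
        f n := by
      ext a
      simp only [generator, LinearMap.comp_apply, AlgHom.toLinearMap_apply,
        TensorAlgebra.lift_ι_apply, DFinsupp.lsingle_apply]
      exact DFinsupp.lsum_single (S := k) f n a
    have hg' (n : ℕ) (a : alternating B n) :
        TensorAlgebra.lift k (DFinsupp.lsum k f) (generator B n a) = f n a :=
      LinearMap.congr_fun (hg n) a
    rintro _ _ (⟨n⟩ | ⟨n, a, b⟩ | ⟨n, a⟩ | ⟨n, a⟩)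
    · exact (hg' n 1).trans ((hf n).map_one.trans (map_one _).symm)
    · rw [map_mul (TensorAlgebra.lift k (DFinsupp.lsum k f))]
      exact (hg' n (a * b)).trans (((hf n).map_mul a b).trans
        (congrArg₂ HMul.hMul (hg' n a) (hg' n b)).symm)
    · have h := mul'_map_comp _ (isMulHom_algHom (TensorAlgebra.lift k (DFinsupp.lsum k f)))
        (generator B n) (generator B (n + 1) ∘ₗ untwist B n) (Coalgebra.comul (R := k) a)
      rw [← LinearMap.comp_assoc, hg, hg, (hf' n).left] at h
      exact h.symm.trans (AlgHom.commutes _ _).symm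
    · have h := mul'_map_comp _ (isMulHom_algHom (TensorAlgebra.lift k (DFinsupp.lsum k f)))
        (generator B (n + 1) ∘ₗ untwist B n) (generator B n) (Coalgebra.comul (R := k) a)
      rw [← LinearMap.comp_assoc, hg, hg, (hf' n).right] at h
      exact h.symm.trans (AlgHom.commutes _ _).symm⟩

lemma algLift_inc (f : ∀ n, alternating B n →ₗ[k] C) (hf : ∀ n, IsMulHom (f n))
    (hf' : ∀ n, ConvInverse (f n) (f (n + 1) ∘ₗ untwist B n)) (n : ℕ) (a : alternating B n) :
    algLift f hf hf' (inc B n a) = f n a := by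
  refine (RingQuot.liftAlgHom_mkAlgHom_apply k _ _ _).trans ?_
  simp only [generator, LinearMap.comp_apply, TensorAlgebra.lift_ι_apply, DFinsupp.lsingle_apply]
  exact DFinsupp.lsum_single (S := k) f n a

end Lift

lemma eq_top_of_inc_mem {T : Subalgebra k (FreeHopf B)} (h : ∀ n a, inc B n a ∈ T) : T = ⊤ := by
  rw [eq_top_iff]
  rintro x -
  obtain ⟨x, rfl⟩ := mk_surjective B x
  induction x using TensorAlgebra.induction with
  | algebraMap r => rw [AlgHom.commutes]; exact T.algebraMap_mem r
  | add a b ha hb => rw [map_add]; exact add_mem ha hb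
  | mul a b ha hb => rw [map_mul]; exact mul_mem ha hb
  | ι m =>
    induction m using DFinsupp.induction with
    | h0 => rw [map_zero, map_zero]; exact zero_mem T
    | ha n a m _ _ hm => rw [map_add, map_add]; exact add_mem (h n a) hm

lemma algHom_ext {C : Type*} [Ring C] [Algebra k C] {f g : FreeHopf B →ₐ[k] C}
    (h : ∀ n a, f (inc B n a) = g (inc B n a)) : f = g := by
  have := eq_top_of_inc_mem (T := AlgHom.equalizer f g) h
  ext x
  have hx : x ∈ AlgHom.equalizer f g := this ▸ Algebra.mem_top
  exact hx

variable (B)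

/-- The comultiplication. -/
noncomputable def comulHom : FreeHopf B →ₐ[k] FreeHopf B ⊗[k] FreeHopf B :=
  algLift (fun n => TensorProduct.map (inc B n) (inc B n) ∘ₗ Coalgebra.comul)
    (fun n => isMulHom_algHom ((Algebra.TensorProduct.map (isMulHom_inc B n).toAlgHom
      (isMulHom_inc B n).toAlgHom).comp (Bialgebra.comulAlgHom k (alternating B n))))
    -- `untwist` reverses coproducts, so the second map is the flipped comultiplication that
    -- `ConvInverse.comul` shows to be inverse to the first.
    (fun n => by
      convert (convInverse_inc B n).comul using 1
      ext a
      simp only [LinearMap.comp_apply, (isAntiComulHom_untwist B n).comul, map_comp_apply,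
        TensorProduct.map_comm, LinearEquiv.coe_coe])

lemma comulHom_inc (n : ℕ) (a : alternating B n) : comulHom B (inc B n a) =
    TensorProduct.map (inc B n) (inc B n) (Coalgebra.comul (R := k) a) :=
  algLift_inc _ _ _ n a

/-- The counit. -/
noncomputable def counitHom : FreeHopf B →ₐ[k] k :=
  algLift (fun n => Coalgebra.counit)
    (fun n => isMulHom_algHom (Bialgebra.counitAlgHom k (alternating B n)))
    (fun n => by
      -- The counit is the identity for convolution of maps to `k`, hence its own inverse.
      have h : (Coalgebra.counit ∘ₗ untwist B n : alternating B n →ₗ[k] k) = Coalgebra.counit :=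
        LinearMap.ext (isAntiComulHom_untwist B n).counit
      have key (a : alternating B n) : LinearMap.mul' k k (TensorProduct.map Coalgebra.counit
          Coalgebra.counit (Coalgebra.comul (R := k) a)) =
          algebraMap k k (Coalgebra.counit (R := k) a) := by
        have := congrArg (LinearMap.mul' k k ∘ₗ LinearMap.lTensor k Coalgebra.counit)
          (Coalgebra.rTensor_counit_comul (R := k) a)
        simpa [LinearMap.lTensor, LinearMap.rTensor, ← map_comp_apply] using this
      rw [h]
      exact ⟨key, key⟩)

lemma counitHom_inc (n : ℕ) (a : alternating B n) :
    counitHom B (inc B n a) = Coalgebra.counit (R := k) a :=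
  algLift_inc _ _ _ n a

noncomputable instance : Bialgebra k (FreeHopf B) :=
  Bialgebra.ofAlgHom (comulHom B) (counitHom B)
    (by
      refine algHom_ext fun n a => ?_
      have key₁ (t : alternating B n ⊗[k] alternating B n) :
          Algebra.TensorProduct.assoc k k k _ _ _ (Algebra.TensorProduct.map (comulHom B)
            (.id k (FreeHopf B)) (TensorProduct.map (inc B n) (inc B n) t)) =
          TensorProduct.map (inc B n) (TensorProduct.map (inc B n) (inc B n))
            (TensorProduct.assoc k _ _ _ (LinearMap.rTensor _ Coalgebra.comul t)) := by
        induction t with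
        | zero => simp
        | add x y hx hy => simp only [map_add, hx, hy]
        | tmul a b =>
          simp only [LinearMap.rTensor_tmul, TensorProduct.map_tmul,
            Algebra.TensorProduct.map_tmul, comulHom_inc, AlgHom.id_apply]
          generalize Coalgebra.comul (R := k) a = s
          induction s with
          | zero => simp
          | add x y hx hy => simp only [map_add, TensorProduct.add_tmul, hx, hy]
          | tmul c d => simp
      have key₂ (t : alternating B n ⊗[k] alternating B n) :
          Algebra.TensorProduct.map (.id k (FreeHopf B)) (comulHom B)
            (TensorProduct.map (inc B n) (inc B n) t) =
          TensorProduct.map (inc B n) (TensorProduct.map (inc B n) (inc B n))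
            (LinearMap.lTensor _ Coalgebra.comul t) := by
        induction t with
        | zero => simp
        | add x y hx hy => simp only [map_add, hx, hy]
        | tmul a b => simp [comulHom_inc]
      change Algebra.TensorProduct.assoc k k k _ _ _ (Algebra.TensorProduct.map (comulHom B)
        (.id k (FreeHopf B)) (comulHom B (inc B n a))) =
        Algebra.TensorProduct.map (.id k (FreeHopf B)) (comulHom B) (comulHom B (inc B n a))
      rw [comulHom_inc, key₁, key₂, Coalgebra.coassoc_apply])
    (by
      refine algHom_ext fun n a => ?_
      have key (t : alternating B n ⊗[k] alternating B n) :
          Algebra.TensorProduct.map (counitHom B) (.id k (FreeHopf B))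
            (TensorProduct.map (inc B n) (inc B n) t) =
          TensorProduct.map LinearMap.id (inc B n) (LinearMap.rTensor _ Coalgebra.counit t) := by
        induction t with
        | zero => simp
        | add x y hx hy => simp only [map_add, hx, hy]
        | tmul a b => simp [counitHom_inc]
      change Algebra.TensorProduct.map (counitHom B) (.id k (FreeHopf B))
        (comulHom B (inc B n a)) = _
      rw [comulHom_inc, key, Coalgebra.rTensor_counit_comul]
      rfl)
    (by
      refine algHom_ext fun n a => ?_
      have key (t : alternating B n ⊗[k] alternating B n) :
          Algebra.TensorProduct.map (.id k (FreeHopf B)) (counitHom B)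
            (TensorProduct.map (inc B n) (inc B n) t) =
          TensorProduct.map (inc B n) LinearMap.id (LinearMap.lTensor _ Coalgebra.counit t) := by
        induction t with
        | zero => simp
        | add x y hx hy => simp only [map_add, hx, hy]
        | tmul a b => simp [counitHom_inc]
      change Algebra.TensorProduct.map (.id k (FreeHopf B)) (counitHom B)
        (comulHom B (inc B n a)) = _
      rw [comulHom_inc, key, Coalgebra.lTensor_counit_comul]
      rfl)

lemma isComulHom_inc (n : ℕ) : IsComulHom (inc B n) :=
  ⟨counitHom_inc B n, comulHom_inc B n⟩

/-- The antipode, as an algebra map to the opposite algebra. -/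
noncomputable def antipodeOp : FreeHopf B →ₐ[k] (FreeHopf B)ᵐᵒᵖ :=
  algLift (fun n => (MulOpposite.opLinearEquiv k).toLinearMap ∘ₗ inc B (n + 1) ∘ₗ untwist B n)
    (fun n => isAntiMulHom_op.comp_anti ((isMulHom_inc B (n + 1)).comp_anti
      (isAntiMulHom_untwist B n)))
    -- The relation in degree `n + 1` is flipped twice, once by the anticomultiplicative `untwist`
    -- and once by passing to the opposite algebra.
    (fun n => ((convInverse_inc B (n + 1)).comp_antiComulHom
      (isAntiComulHom_untwist B n)).antiMulHom_comp isAntiMulHom_op)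

/-- The antipode. -/
noncomputable def antipode : FreeHopf B →ₗ[k] FreeHopf B :=
  (MulOpposite.opLinearEquiv k).symm.toLinearMap ∘ₗ (antipodeOp B).toLinearMap

lemma antipode_inc (n : ℕ) (a : alternating B n) :
    antipode B (inc B n a) = inc B (n + 1) (untwist B n a) :=
  congrArg MulOpposite.unop (algLift_inc _ _ _ n a)

lemma isAntiMulHom_antipode' : IsAntiMulHom (antipode B) :=
  isAntiMulHom_unop.comp (isMulHom_algHom _)

/-- The antipodal space is a subalgebra, and on generators its defining identities are the imposed
relations. -/
lemma mem_antipodalSpace_antipode (x : FreeHopf B) : x ∈ antipodalSpace (antipode B) := by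
  let T : Subalgebra k (FreeHopf B) := (antipodalSpace (antipode B)).toSubalgebra
    (one_mem_antipodalSpace (isAntiMulHom_antipode' B))
    (fun _ _ => mul_mem_antipodalSpace (isAntiMulHom_antipode' B))
  have h : T = ⊤ := by
    refine eq_top_of_inc_mem fun n a => ?_
    have hn : antipode B ∘ₗ inc B n = inc B (n + 1) ∘ₗ untwist B n :=
      LinearMap.ext (antipode_inc B n)
    have := convInverse_inc B n
    rw [← hn] at this
    refine mem_antipodalSpace.2 ?_
    rw [(isComulHom_inc B n).comul, (isComulHom_inc B n).counit, LinearMap.lTensor,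
      LinearMap.rTensor, ← map_comp_apply, ← map_comp_apply]
    exact ⟨this.left a, this.right a⟩
  have hx : x ∈ T := h ▸ Algebra.mem_top
  exact hx

noncomputable instance : HopfAlgebra k (FreeHopf B) where
  antipode := antipode B
  mul_antipode_rTensor_comul :=
    LinearMap.ext fun x => (mem_antipodalSpace.1 (mem_antipodalSpace_antipode B x)).2
  mul_antipode_lTensor_comul :=
    LinearMap.ext fun x => (mem_antipodalSpace.1 (mem_antipodalSpace_antipode B x)).1

/-- The unit of the adjunction. -/
noncomputable def unit : B →ₐc[k] FreeHopf B :=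
  toBialgHom (A := alternating B 0) (inc B 0) (isMulHom_inc B 0) (isComulHom_inc B 0)

variable {B}

/-- The generators of degree `n + 1` are the antipodes of those of degree `n`, and `f` and `g`
commute with antipodes. -/
lemma hom_ext {X : Type*} [Ring X] [HopfAlgebra k X] {f g : FreeHopf B →ₐc[k] X}
    (h : ∀ b, f (unit B b) = g (unit B b)) : f = g := by
  have h' (n : ℕ) : ∀ a, f (inc B n a) = g (inc B n a) := by
    induction n with
    | zero => exact h
    | succ n ih =>
      intro a
      obtain ⟨a, rfl⟩ := untwist_surjective B n a
      have key (f : FreeHopf B →ₐc[k] X) : f (inc B (n + 1) (untwist B n a)) =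
          HopfAlgebra.antipode k (f (inc B n a)) := by
        rw [antipode_bialgHom_apply, ← antipode_inc]
        rfl
      rw [key, key, ih]
  have := algHom_ext (f := (f : FreeHopf B →ₐ[k] X)) (g := g) h'
  ext x
  exact congr($this x)

/-- The maps `S^n ∘ f : B_n → X`. -/
noncomputable def component {X : Type*} [Ring X] [HopfAlgebra k X] (f : B →ₐc[k] X) :
    (n : ℕ) → alternating B n →ₐc[k] X
  | 0 => f
  | n + 1 => toBialgHom (HopfAlgebra.antipode k ∘ₗ (component f n : alternating B n →ₗ[k] X) ∘ₗ
      (twist B n).toLinearMap)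
      (isAntiMulHom_antipode.comp_anti
        ((isMulHom_bialgHom _).comp_anti (isAntiMulHom_twist B n)))
      (isAntiComulHom_antipode.comp_anti
        ((isComulHom_bialgHom _).comp_anti (isAntiComulHom_twist B n)))

lemma component_untwist {X : Type*} [Ring X] [HopfAlgebra k X] (f : B →ₐc[k] X) (n : ℕ) :
    (component f (n + 1) : alternating B (n + 1) →ₗ[k] X) ∘ₗ untwist B n =
      HopfAlgebra.antipode k ∘ₗ (component f n : alternating B n →ₗ[k] X) := by
  ext a
  exact congrArg (fun b => HopfAlgebra.antipode k (component f n b))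
    ((twist B n).apply_symm_apply a)

lemma exists_lift {X : Type*} [Ring X] [HopfAlgebra k X] (f : B →ₐc[k] X) :
    ∃ g : FreeHopf B →ₐc[k] X, ∀ b, g (unit B b) = f b := by
  let G : FreeHopf B →ₐ[k] X := algLift
    (fun n => (component f n : alternating B n →ₗ[k] X))
    (fun n => isMulHom_bialgHom _)
    -- Degree `n + 1` is degree `n` followed by the antipode of `X`, which yields a convolution
    -- inverse.
    (fun n => by
      rw [component_untwist]
      exact convInverse_antipode.comp_comulHom (isComulHom_bialgHom _))
  have hG (n : ℕ) (a : alternating B n) : G (inc B n a) = component f n a := algLift_inc _ _ _ n a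
  have hG' (n : ℕ) : G.toLinearMap ∘ₗ inc B n = (component f n : alternating B n →ₗ[k] X) :=
    LinearMap.ext (hG n)
  have h₁ : (Bialgebra.counitAlgHom k X).comp G = Bialgebra.counitAlgHom k (FreeHopf B) := by
    refine algHom_ext fun n a => ?_
    change Coalgebra.counit (R := k) (G (inc B n a)) = Coalgebra.counit (R := k) (inc B n a)
    rw [hG, (isComulHom_inc B n).counit]
    exact (isComulHom_bialgHom _).counit a
  have h₂ : (Algebra.TensorProduct.map G G).comp (Bialgebra.comulAlgHom k (FreeHopf B)) =
      (Bialgebra.comulAlgHom k X).comp G := by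
    refine algHom_ext fun n a => ?_
    change TensorProduct.map G.toLinearMap G.toLinearMap
      (Coalgebra.comul (R := k) (inc B n a)) = Coalgebra.comul (R := k) (G (inc B n a))
    rw [hG, (isComulHom_inc B n).comul, ← map_comp_apply, hG']
    exact ((isComulHom_bialgHom _).comul a).symm
  exact ⟨BialgHom.ofAlgHom G h₁ h₂, hG 0⟩

end FreeHopf

end FreeHopf


/-! ### Opposite Hopf algebras. -/

section Opposites

variable {k : Type u} [Field k]

lemma isAntiMulHom_opBialgEquiv (B : BialgCat.{u} k) :
    IsAntiMulHom (opBialgEquiv B).toLinearMap := ⟨rfl, fun _ _ => rfl⟩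

lemma isComulHom_opBialgEquiv (B : BialgCat.{u} k) :
    IsComulHom (opBialgEquiv B).toLinearMap := ⟨fun _ => rfl, fun _ => rfl⟩

lemma isAntiMulHom_opHopfEquiv (H : HopfAlgCat.{u} k)
    (h : Function.Bijective (HopfAlgebra.antipode k : H →ₗ[k] H)) :
    IsAntiMulHom (opHopfEquiv H h).toLinearMap := ⟨rfl, fun _ _ => rfl⟩

lemma isComulHom_opHopfEquiv (H : HopfAlgCat.{u} k)
    (h : Function.Bijective (HopfAlgebra.antipode k : H →ₗ[k] H)) :
    IsComulHom (opHopfEquiv H h).toLinearMap := ⟨fun _ => rfl, fun _ => rfl⟩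

/-- The antipode of `H^{op}` is bijective. -/
lemma bijective_antipode_opHopf (H : HopfAlgCat.{u} k)
    (h : Function.Bijective (HopfAlgebra.antipode k : H →ₗ[k] H)) :
    Function.Bijective (HopfAlgebra.antipode k : opHopf H h →ₗ[k] opHopf H h) :=
  ((opHopfEquiv H h).symm.trans ((LinearEquiv.ofBijective (HopfAlgebra.antipode k) h).symm.trans
    (opHopfEquiv H h))).bijective

variable (Q : Type u) [Ring Q] [HopfAlgebra k Q]

variable (k) in
/-- The Hopf algebra `Q^{op,cop}`, with the antipode of `Q`. -/
abbrev OpCop : Type u := opCop (BialgCat.of k Q)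

variable (k) in
/-- The identity map `Q → Q^{op,cop}`. -/
noncomputable def toOpCop : Q ≃ₗ[k] OpCop k Q := opCopEquiv (BialgCat.of k Q)

lemma isAntiMulHom_toOpCop : IsAntiMulHom (toOpCop k Q).toLinearMap :=
  isAntiMulHom_opCopEquiv _

lemma isAntiComulHom_toOpCop : IsAntiComulHom (toOpCop k Q).toLinearMap :=
  isAntiComulHom_opCopEquiv _

lemma convInverse_opCop : ConvInverse (LinearMap.id : OpCop k Q →ₗ[k] OpCop k Q)
    ((toOpCop k Q).toLinearMap ∘ₗ HopfAlgebra.antipode k ∘ₗ (toOpCop k Q).symm.toLinearMap) := by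
  have h := ((convInverse_antipode (k := k) (H := Q)).antiMulHom_comp
    (isAntiMulHom_toOpCop Q)).comp_antiComulHom (isAntiComulHom_toOpCop Q).symm
  rwa [show ((toOpCop k Q).toLinearMap ∘ₗ LinearMap.id) ∘ₗ (toOpCop k Q).symm.toLinearMap =
    LinearMap.id from LinearMap.ext (toOpCop k Q).apply_symm_apply, LinearMap.comp_assoc] at h

noncomputable instance : HopfAlgebra k (OpCop k Q) where
  antipode := (toOpCop k Q).toLinearMap ∘ₗ HopfAlgebra.antipode k ∘ₗ
    (toOpCop k Q).symm.toLinearMap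
  mul_antipode_rTensor_comul := LinearMap.ext (convInverse_opCop Q).right
  mul_antipode_lTensor_comul := LinearMap.ext (convInverse_opCop Q).left

lemma antipode_toOpCop (x : Q) : HopfAlgebra.antipode k (toOpCop k Q x) =
    toOpCop k Q (HopfAlgebra.antipode k x) :=
  congrArg (fun y => toOpCop k Q (HopfAlgebra.antipode k y)) ((toOpCop k Q).symm_apply_apply x)

end Opposites

/-! ### Bijectivity of the antipode of the (co)free Hopf algebra on `H^{op}`. -/

section BijectiveAntipode

variable {k : Type u} [Field k] {H : HopfAlgCat.{u} k} {Q : Type u} [Ring Q] [HopfAlgebra k Q]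

/-- The antipode of the Hopf algebra cofreely generated by `H^{op}` is bijective. -/
lemma bijective_antipode_of_cofree (q : Q →ₐc[k] hopfOpBialg H)
    (hl : ∀ (X : Type u) [Ring X] [HopfAlgebra k X] (f : X →ₐc[k] hopfOpBialg H),
      ∃ g : X →ₐc[k] Q, ∀ x, q (g x) = f x)
    (hu : ∀ {X : Type u} [Ring X] [HopfAlgebra k X] {f g : X →ₐc[k] Q},
      (∀ x, q (f x) = q (g x)) → f = g) :
    Function.Bijective (HopfAlgebra.antipode k : Q →ₗ[k] Q) := by
  let S : Q →ₗ[k] Q := HopfAlgebra.antipode k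
  let s : H →ₗ[k] H := HopfAlgebra.antipode k
  have hS : IsAntiMulHom S := isAntiMulHom_antipode
  have hS' : IsAntiComulHom S := isAntiComulHom_antipode
  have hs : IsAntiMulHom s := isAntiMulHom_antipode
  have hs' : IsAntiComulHom s := isAntiComulHom_antipode
  let ε : H ≃ₗ[k] hopfOpBialg H := opBialgEquiv ((hopfToBialg k).obj H)
  have hε : IsAntiMulHom ε.toLinearMap := isAntiMulHom_opBialgEquiv ((hopfToBialg k).obj H)
  have hε' : IsComulHom ε.toLinearMap := isComulHom_opBialgEquiv ((hopfToBialg k).obj H)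
  let q' : Q →ₗ[k] H := ε.symm.toLinearMap ∘ₗ (q : Q →ₗ[k] hopfOpBialg H)
  have hq : IsAntiMulHom q' := hε.symm.comp (isMulHom_bialgHom q)
  have hq' : IsComulHom q' := hε'.symm.comp (isComulHom_bialgHom q)
  -- Both sides are skew inverses of `q' ∘ S`: the left one because `q'` reverses products, the
  -- right one because `q' ∘ S` reverses coproducts.
  have hsqS : q' = s ∘ₗ q' ∘ₗ S :=
    ((convInverse_antipode (k := k) (H := Q)).antiMulHom_comp hq).symm.unique
      ((convInverse_antipode (k := k) (H := H)).comp_antiComulHom (hq'.comp_anti hS'))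
  let e := toOpCop k Q
  -- The candidate for the inverse of `S` is the lift of `s ∘ q'`, which is a bialgebra map once its
  -- source is read as `Q^{op,cop}`.
  obtain ⟨G, hG⟩ := hl (OpCop k Q) (toBialgHom (ε.toLinearMap ∘ₗ s ∘ₗ q' ∘ₗ e.symm.toLinearMap)
    (hε.comp_anti (hs.comp (hq.comp_anti (isAntiMulHom_toOpCop Q).symm)))
    (hε'.comp (hs'.comp_anti (hq'.comp_anti (isAntiComulHom_toOpCop Q).symm))))
  have hG' : IsAntiMulHom ((G : OpCop k Q →ₗ[k] Q) ∘ₗ e.toLinearMap) :=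
    (isMulHom_bialgHom G).comp_anti (isAntiMulHom_toOpCop Q)
  have hG'' : IsAntiComulHom ((G : OpCop k Q →ₗ[k] Q) ∘ₗ e.toLinearMap) :=
    (isComulHom_bialgHom G).comp_anti (isAntiComulHom_toOpCop Q)
  -- The composite `G ∘ e ∘ S` reverses twice, so it is a bialgebra endomorphism of `Q`. It lies
  -- over `s ∘ q' ∘ S = q'`, as the identity does.
  have hGS (x : Q) : G (e (S x)) = x := by
    have := hu (f := toBialgHom _ (hG'.comp_anti hS) (hG''.comp_anti hS'))
      (g := BialgHom.id k Q) fun x => by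
        refine (hG (e (S x))).trans ?_
        change ε (s (q' (e.symm (e (S x))))) = q x
        rw [e.symm_apply_apply, ← ε.apply_symm_apply (q x)]
        exact congrArg ε (LinearMap.congr_fun hsqS x).symm
    exact congr($this x)
  -- `Q^{op,cop}` has the same antipode as `Q`, and `G` commutes with antipodes, so the other
  -- composite equals the one just computed.
  have hSG (x : Q) : S (G (e x)) = x := by
    refine (antipode_bialgHom_apply G (e x)).trans ?_
    rw [antipode_toOpCop]
    exact hGS x
  exact Function.bijective_iff_has_inverse.2 ⟨fun x => G (e x), hGS, hSG⟩

/-- The antipode of the Hopf algebra freely generated by `H^{op}` is bijective. -/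
lemma bijective_antipode_of_free (q : hopfOpBialg H →ₐc[k] Q)
    (hl : ∀ (X : Type u) [Ring X] [HopfAlgebra k X] (f : hopfOpBialg H →ₐc[k] X),
      ∃ g : Q →ₐc[k] X, ∀ x, g (q x) = f x)
    (hu : ∀ {X : Type u} [Ring X] [HopfAlgebra k X] {f g : Q →ₐc[k] X},
      (∀ x, f (q x) = g (q x)) → f = g) :
    Function.Bijective (HopfAlgebra.antipode k : Q →ₗ[k] Q) := by
  let S : Q →ₗ[k] Q := HopfAlgebra.antipode k
  let s : H →ₗ[k] H := HopfAlgebra.antipode k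
  have hS : IsAntiMulHom S := isAntiMulHom_antipode
  have hS' : IsAntiComulHom S := isAntiComulHom_antipode
  have hs : IsAntiMulHom s := isAntiMulHom_antipode
  have hs' : IsAntiComulHom s := isAntiComulHom_antipode
  let ε : H ≃ₗ[k] hopfOpBialg H := opBialgEquiv ((hopfToBialg k).obj H)
  have hε : IsAntiMulHom ε.toLinearMap := isAntiMulHom_opBialgEquiv ((hopfToBialg k).obj H)
  have hε' : IsComulHom ε.toLinearMap := isComulHom_opBialgEquiv ((hopfToBialg k).obj H)
  let q' : H →ₗ[k] Q := (q : hopfOpBialg H →ₗ[k] Q) ∘ₗ ε.toLinearMap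
  have hq : IsAntiMulHom q' := (isMulHom_bialgHom q).comp_anti hε
  have hq' : IsComulHom q' := (isComulHom_bialgHom q).comp hε'
  -- Dually, both sides are skew inverses of `q' ∘ s`.
  have hSqs : q' = S ∘ₗ q' ∘ₗ s :=
    ((convInverse_antipode (k := k) (H := H)).antiMulHom_comp hq).symm.unique
      ((convInverse_antipode (k := k) (H := Q)).comp_antiComulHom (hq'.comp_anti hs'))
  let e := toOpCop k Q
  have he : IsAntiMulHom e.toLinearMap := isAntiMulHom_toOpCop Q
  have he' : IsAntiComulHom e.toLinearMap := isAntiComulHom_toOpCop Q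
  -- Here the inverse of `S` is the extension of `q' ∘ s` to a map `Q → Q^{op,cop}`.
  obtain ⟨G, hG⟩ := hl (OpCop k Q) (toBialgHom (e.toLinearMap ∘ₗ (q' ∘ₗ s) ∘ₗ ε.symm.toLinearMap)
    (he.comp_anti ((hq.comp_anti hs).comp_anti hε.symm))
    (he'.comp_anti ((hq'.comp_anti hs').comp hε'.symm)))
  have hG' : IsAntiMulHom (e.symm.toLinearMap ∘ₗ (G : Q →ₗ[k] OpCop k Q)) :=
    he.symm.comp (isMulHom_bialgHom G)
  have hG'' : IsAntiComulHom (e.symm.toLinearMap ∘ₗ (G : Q →ₗ[k] OpCop k Q)) :=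
    he'.symm.comp (isComulHom_bialgHom G)
  have hSG (x : Q) : S (e.symm (G x)) = x := by
    have := hu (f := toBialgHom _ (hS.comp_anti hG') (hS'.comp_anti hG''))
      (g := BialgHom.id k Q) fun y => by
        change S (e.symm (G (q y))) = q y
        rw [hG]
        change S (e.symm (e (q' (s (ε.symm y))))) = q y
        rw [e.symm_apply_apply]
        refine (LinearMap.congr_fun hSqs (ε.symm y)).symm.trans ?_
        exact congrArg q (ε.apply_symm_apply y)
    exact congr($this x)
  have hGS (x : Q) : e.symm (G (S x)) = x := by
    refine .trans ?_ (hSG x)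
    apply e.injective
    rw [e.apply_symm_apply]
    refine (antipode_bialgHom_apply G x).symm.trans ?_
    rw [← antipode_toOpCop]
    exact congrArg _ (e.apply_symm_apply (G x)).symm
  exact Function.bijective_iff_has_inverse.2 ⟨fun x => e.symm (G x), hGS, hSG⟩

end BijectiveAntipode

/-! ### Adjoints from universal arrows. -/

section Adjunctions

variable {C D : Type*} [Category C] [Category D]

/-- A functor with universal arrows to all objects has a right adjoint. -/
noncomputable def rightAdjointOfUniversal (F : C ⥤ D) (G : D → C) (ε : ∀ Y, F.obj (G Y) ⟶ Y)
    (h : ∀ X Y, Function.Bijective fun g : X ⟶ G Y => F.map g ≫ ε Y) : D ⥤ C :=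
  Adjunction.rightAdjointOfEquiv (F := F) (G_obj := G)
    (fun X Y => (Equiv.ofBijective _ (h X Y)).symm)
    (fun X' X Y f g => by
      rw [Equiv.symm_apply_eq]
      simp [Category.assoc, Equiv.ofBijective_apply_symm_apply _ (h X Y)])

/-- The adjunction given by universal arrows. -/
noncomputable def adjunctionOfUniversal (F : C ⥤ D) (G : D → C) (ε : ∀ Y, F.obj (G Y) ⟶ Y)
    (h : ∀ X Y, Function.Bijective fun g : X ⟶ G Y => F.map g ≫ ε Y) :
    F ⊣ rightAdjointOfUniversal F G ε h :=
  Adjunction.adjunctionOfEquivRight _ _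

lemma adjunctionOfUniversal_counit_app (F : C ⥤ D) (G : D → C) (ε : ∀ Y, F.obj (G Y) ⟶ Y)
    (h : ∀ X Y, Function.Bijective fun g : X ⟶ G Y => F.map g ≫ ε Y) (Y : D) :
    (adjunctionOfUniversal F G ε h).counit.app Y = ε Y := by
  refine (Adjunction.adjunctionOfEquivRight_counit_app _ _ _).trans ?_
  simp

/-- A functor with universal arrows from all objects is a right adjoint. -/
lemma isRightAdjoint_of_universal (F : C ⥤ D) (G : D → C) (η : ∀ Y, Y ⟶ F.obj (G Y))
    (h : ∀ Y X, Function.Bijective fun g : G Y ⟶ X => η Y ≫ F.map g) : F.IsRightAdjoint :=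
  (Adjunction.adjunctionOfEquivLeft (G := F) (F_obj := G)
    (fun Y X => Equiv.ofBijective _ (h Y X)) (by simp)).isRightAdjoint

end Adjunctions


/-! ### Both adjoints of the inclusion of Hopf algebras into bialgebras. -/

section HopfInBialg

variable {k : Type u} [Field k]

/-- The Hopf algebra cofreely generated by a bialgebra, from a chosen product of the alternating
copies. -/
noncomputable def cofreeHopfCat (B : BialgCat.{u} k) : HopfAlgCat.{u} k :=
  HopfAlgCat.of k
    (CofreeHopf (hasProduct_bialgCat (alternating B)).exists_limit.some.isLimit)

/-- The universal bialgebra map to `B` from a Hopf algebra. -/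
noncomputable def cofreeHopfCounit (B : BialgCat.{u} k) : cofreeHopfCat B →ₐc[k] B :=
  CofreeHopf.counit (hasProduct_bialgCat (alternating B)).exists_limit.some.isLimit

lemma cofreeHopfCat_hom_ext {B : BialgCat.{u} k} {X : Type u} [Ring X] [HopfAlgebra k X]
    {f g : X →ₐc[k] cofreeHopfCat B}
    (h : ∀ x, cofreeHopfCounit B (f x) = cofreeHopfCounit B (g x)) : f = g :=
  CofreeHopf.hom_ext h

lemma cofreeHopfCat_exists_lift {B : BialgCat.{u} k} {X : Type u} [Ring X] [HopfAlgebra k X]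
    (f : X →ₐc[k] B) : ∃ g : X →ₐc[k] cofreeHopfCat B, ∀ x, cofreeHopfCounit B (g x) = f x :=
  CofreeHopf.exists_lift _ f

lemma bijective_comp_cofreeHopfCounit (X : HopfAlgCat.{u} k) (B : BialgCat.{u} k) :
    Function.Bijective fun g : X ⟶ cofreeHopfCat B =>
      (hopfToBialg k).map g ≫ (⟨cofreeHopfCounit B⟩ : (hopfToBialg k).obj (cofreeHopfCat B) ⟶ B) := by
  refine ⟨fun f g h => HopfAlgCat.hom_ext _ _ (cofreeHopfCat_hom_ext fun x => ?_), fun f => ?_⟩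
  · exact congr(($h).toBialgHom x)
  · obtain ⟨g, hg⟩ := cofreeHopfCat_exists_lift (X := X) f.toBialgHom
    exact ⟨⟨g⟩, BialgCat.hom_ext _ _ (BialgHom.ext hg)⟩

variable (k) in
/-- The inclusion of Hopf algebras into bialgebras has a left adjoint. -/
lemma isRightAdjoint_hopfToBialg : (hopfToBialg k).IsRightAdjoint := by
  refine isRightAdjoint_of_universal (hopfToBialg k) (fun B => HopfAlgCat.of k (FreeHopf B))
    (fun B => ⟨FreeHopf.unit B⟩) fun B X => ⟨fun f g h => ?_, fun f => ?_⟩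
  · exact HopfAlgCat.hom_ext _ _ (FreeHopf.hom_ext fun x => congr(($h).toBialgHom x))
  · obtain ⟨g, hg⟩ := FreeHopf.exists_lift (X := X) f.toBialgHom
    exact ⟨⟨g⟩, BialgCat.hom_ext _ _ (BialgHom.ext hg)⟩

end HopfInBialg

/-! ### Transporting maps to opposite algebras. -/

section OppositeMaps

variable {k : Type u} [Field k]

/-- A bialgebra map `X → H`, regarded as a map `X^{op} → H^{op}` to the opposite bialgebra. -/
noncomputable def opMap {X H : HopfAlgCat.{u} k} (hX : bijectiveAntipode k X) (f : X →ₐc[k] H) :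
    opHopf X hX →ₐc[k] hopfOpBialg H :=
  toBialgHom ((opBialgEquiv ((hopfToBialg k).obj H)).toLinearMap ∘ₗ (f : X →ₗ[k] H) ∘ₗ
      (opHopfEquiv X hX).symm.toLinearMap)
    ((isAntiMulHom_opBialgEquiv _).comp_anti
      ((isMulHom_bialgHom f).comp_anti (isAntiMulHom_opHopfEquiv X hX).symm))
    ((isComulHom_opBialgEquiv _).comp
      ((isComulHom_bialgHom f).comp (isComulHom_opHopfEquiv X hX).symm))

/-- A bialgebra map `X → H^{op}`, regarded as a map `X^{op} → H`. -/
noncomputable def unopMap {X H : HopfAlgCat.{u} k} (hX : bijectiveAntipode k X)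
    (f : X →ₐc[k] hopfOpBialg H) : opHopf X hX →ₐc[k] H :=
  toBialgHom ((opBialgEquiv ((hopfToBialg k).obj H)).symm.toLinearMap ∘ₗ
      (f : X →ₗ[k] hopfOpBialg H) ∘ₗ (opHopfEquiv X hX).symm.toLinearMap)
    ((isAntiMulHom_opBialgEquiv _).symm.comp_anti
      ((isMulHom_bialgHom f).comp_anti (isAntiMulHom_opHopfEquiv X hX).symm))
    ((isComulHom_opBialgEquiv _).symm.comp
      ((isComulHom_bialgHom f).comp (isComulHom_opHopfEquiv X hX).symm))

/-- A bialgebra map `H^{op} → X`, regarded as a map `H → X^{op}`. -/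
noncomputable def mapOp {X H : HopfAlgCat.{u} k} (hX : bijectiveAntipode k X)
    (f : hopfOpBialg H →ₐc[k] X) : H →ₐc[k] opHopf X hX :=
  toBialgHom ((opHopfEquiv X hX).toLinearMap ∘ₗ (f : hopfOpBialg H →ₗ[k] X) ∘ₗ
      (opBialgEquiv ((hopfToBialg k).obj H)).toLinearMap)
    ((isAntiMulHom_opHopfEquiv X hX).comp_anti
      ((isMulHom_bialgHom f).comp_anti (isAntiMulHom_opBialgEquiv _)))
    ((isComulHom_opHopfEquiv X hX).comp
      ((isComulHom_bialgHom f).comp (isComulHom_opBialgEquiv _)))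

/-- A bialgebra map `H → X`, regarded as a map `H^{op} → X^{op}` from the opposite bialgebra. -/
noncomputable def opMap' {X H : HopfAlgCat.{u} k} (hX : bijectiveAntipode k X) (f : H →ₐc[k] X) :
    hopfOpBialg H →ₐc[k] opHopf X hX :=
  toBialgHom ((opHopfEquiv X hX).toLinearMap ∘ₗ (f : H →ₗ[k] X) ∘ₗ
      (opBialgEquiv ((hopfToBialg k).obj H)).symm.toLinearMap)
    ((isAntiMulHom_opHopfEquiv X hX).comp_anti
      ((isMulHom_bialgHom f).comp_anti (isAntiMulHom_opBialgEquiv _).symm))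
    ((isComulHom_opHopfEquiv X hX).comp
      ((isComulHom_bialgHom f).comp (isComulHom_opBialgEquiv _).symm))

/-- A Hopf algebra map `X → Y^{op}`, regarded as a map `X^{op} → Y`. -/
noncomputable def unopHopfMap {X Y : HopfAlgCat.{u} k} (hX : bijectiveAntipode k X)
    (hY : bijectiveAntipode k Y) (f : X →ₐc[k] opHopf Y hY) : opHopf X hX →ₐc[k] Y :=
  toBialgHom ((opHopfEquiv Y hY).symm.toLinearMap ∘ₗ (f : X →ₗ[k] opHopf Y hY) ∘ₗ
      (opHopfEquiv X hX).symm.toLinearMap)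
    ((isAntiMulHom_opHopfEquiv Y hY).symm.comp_anti
      ((isMulHom_bialgHom f).comp_anti (isAntiMulHom_opHopfEquiv X hX).symm))
    ((isComulHom_opHopfEquiv Y hY).symm.comp
      ((isComulHom_bialgHom f).comp (isComulHom_opHopfEquiv X hX).symm))

/-- A Hopf algebra map `X^{op} → Y`, regarded as a map `X → Y^{op}`. -/
noncomputable def hopfMapOp {X Y : HopfAlgCat.{u} k} (hX : bijectiveAntipode k X)
    (hY : bijectiveAntipode k Y) (f : opHopf X hX →ₐc[k] Y) : X →ₐc[k] opHopf Y hY :=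
  toBialgHom ((opHopfEquiv Y hY).toLinearMap ∘ₗ (f : opHopf X hX →ₗ[k] Y) ∘ₗ
      (opHopfEquiv X hX).toLinearMap)
    ((isAntiMulHom_opHopfEquiv Y hY).comp_anti
      ((isMulHom_bialgHom f).comp_anti (isAntiMulHom_opHopfEquiv X hX)))
    ((isComulHom_opHopfEquiv Y hY).comp
      ((isComulHom_bialgHom f).comp (isComulHom_opHopfEquiv X hX)))

end OppositeMaps

/-! ### Both adjoints of the inclusion of Hopf algebras with bijective antipode. -/

section SHopfInHopf

variable {k : Type u} [Field k]

lemma bijectiveAntipode_cofreeHopfCat (H : HopfAlgCat.{u} k) :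
    bijectiveAntipode k (cofreeHopfCat (hopfOpBialg H)) :=
  bijective_antipode_of_cofree (cofreeHopfCounit (hopfOpBialg H))
    (fun _ _ _ f => cofreeHopfCat_exists_lift f) cofreeHopfCat_hom_ext

/-- The Hopf algebra with bijective antipode cofreely generated by a Hopf algebra. -/
noncomputable def cofreeSHopf (H : HopfAlgCat.{u} k) : SHopfAlgCat k :=
  ⟨opHopf (cofreeHopfCat (hopfOpBialg H)) (bijectiveAntipode_cofreeHopfCat H),
    bijective_antipode_opHopf _ _⟩

/-- The universal map to `H` from a Hopf algebra with bijective antipode. -/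
noncomputable def cofreeSHopfCounit (H : HopfAlgCat.{u} k) :
    (shopfToHopf k).obj (cofreeSHopf H) ⟶ H :=
  ⟨unopMap (bijectiveAntipode_cofreeHopfCat H) (cofreeHopfCounit (hopfOpBialg H))⟩

/-- Bijectivity of the antipode of `X` makes `X^{op}` a Hopf algebra, so the universal property of
the cofree Hopf algebra on `H^{op}` can be applied to it and the result read in the opposite
algebras. -/
lemma bijective_comp_cofreeSHopfCounit (X : SHopfAlgCat k) (H : HopfAlgCat.{u} k) :
    Function.Bijective fun g : X ⟶ cofreeSHopf H =>
      (shopfToHopf k).map g ≫ cofreeSHopfCounit H := by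
  have hQ := bijectiveAntipode_cofreeHopfCat H
  refine ⟨fun f g h => ObjectProperty.hom_ext _ (HopfAlgCat.hom_ext _ _ ?_), fun f => ?_⟩
  · have := cofreeHopfCat_hom_ext (B := hopfOpBialg H) (f := unopHopfMap X.2 hQ f.hom.toBialgHom)
      (g := unopHopfMap X.2 hQ g.hom.toBialgHom) fun x =>
        (opBialgEquiv ((hopfToBialg k).obj H)).symm.injective
          congr(($h).toBialgHom ((opHopfEquiv X.obj X.2).symm x))
    exact BialgHom.ext fun x =>
      (opHopfEquiv _ hQ).symm.injective congr($this (opHopfEquiv X.obj X.2 x))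
  · obtain ⟨g, hg⟩ := cofreeHopfCat_exists_lift (opMap X.2 f.toBialgHom)
    refine ⟨⟨⟨hopfMapOp X.2 hQ g⟩⟩, HopfAlgCat.hom_ext _ _ (BialgHom.ext fun x => ?_)⟩
    exact congrArg (opBialgEquiv ((hopfToBialg k).obj H)).symm (hg (opHopfEquiv X.obj X.2 x))

lemma bijectiveAntipode_freeHopf (H : HopfAlgCat.{u} k) :
    bijectiveAntipode k (HopfAlgCat.of k (FreeHopf (hopfOpBialg H))) :=
  bijective_antipode_of_free (FreeHopf.unit (hopfOpBialg H))
    (fun _ _ _ f => FreeHopf.exists_lift f) FreeHopf.hom_ext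

variable (k) in
/-- The inclusion of Hopf algebras with bijective antipode into Hopf algebras has a left
adjoint. -/
lemma isRightAdjoint_shopfToHopf : (shopfToHopf k).IsRightAdjoint := by
  refine isRightAdjoint_of_universal (shopfToHopf k)
    (fun H => ⟨opHopf _ (bijectiveAntipode_freeHopf H), bijective_antipode_opHopf _ _⟩)
    (fun H => ⟨mapOp (bijectiveAntipode_freeHopf H) (FreeHopf.unit (hopfOpBialg H))⟩)
    fun H X => ?_
  have hQ := bijectiveAntipode_freeHopf H
  refine ⟨fun f g h => ObjectProperty.hom_ext _ (HopfAlgCat.hom_ext _ _ ?_), fun f => ?_⟩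
  · have := FreeHopf.hom_ext (B := hopfOpBialg H) (f := hopfMapOp hQ X.2 f.hom.toBialgHom)
      (g := hopfMapOp hQ X.2 g.hom.toBialgHom) fun x =>
        congrArg (opHopfEquiv X.obj X.2)
          congr(($h).toBialgHom ((opBialgEquiv ((hopfToBialg k).obj H)).symm x))
    exact BialgHom.ext fun x =>
      (opHopfEquiv X.obj X.2).injective congr($this ((opHopfEquiv _ hQ).symm x))
  · obtain ⟨g, hg⟩ := FreeHopf.exists_lift (opMap' X.2 f.toBialgHom)
    refine ⟨⟨⟨unopHopfMap hQ X.2 g⟩⟩, HopfAlgCat.hom_ext _ _ (BialgHom.ext fun x => ?_)⟩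
    exact congrArg (opHopfEquiv X.obj X.2).symm (hg (opBialgEquiv ((hopfToBialg k).obj H) x))

end SHopfInHopf

/-! ### Independence of the chosen product. -/

section Description

variable {k : Type u} [Field k]

/-- The Hopf algebra cofreely generated by `B`, embedded into any product of the alternating
copies. -/
lemma exists_cofreeHopfCat_incl {B : BialgCat.{u} k} {c : Fan (alternating B)} (hc : IsLimit c) :
    ∃ incl : cofreeHopfCat B →ₐc[k] c.pt, Function.Injective incl ∧
      LinearMap.range (incl : cofreeHopfCat B →ₗ[k] c.pt) = antipodalPart hc ∧
      (∀ x : cofreeHopfCat B, incl (HopfAlgebra.antipode k x) = shiftLin hc (incl x)) ∧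
      ∀ x : cofreeHopfCat B, (c.proj 0).toBialgHom (incl x) = cofreeHopfCounit B x := by
  -- The adjoint was built from one chosen product. The antipodal part of any other product has the
  -- same universal property, so `φ` and `ψ` are mutually inverse.
  obtain ⟨φ, hφ⟩ := CofreeHopf.exists_lift hc (cofreeHopfCounit B)
  obtain ⟨ψ, hψ⟩ := cofreeHopfCat_exists_lift (CofreeHopf.counit hc)
  have h₁ : ψ.comp φ = BialgHom.id k (cofreeHopfCat B) :=
    cofreeHopfCat_hom_ext fun x => (hψ (φ x)).trans (hφ x)
  have h₂ : φ.comp ψ = BialgHom.id k (CofreeHopf hc) :=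
    CofreeHopf.hom_ext fun x => (hφ (ψ x)).trans (hψ x)
  refine ⟨(CofreeHopf.incl hc).comp φ, ?_, ?_, fun x => ?_, hφ⟩
  · exact (CofreeHopf.incl_injective hc).comp
      (Function.LeftInverse.injective (g := ψ) fun x => congr($h₁ x))
  · rw [← CofreeHopf.range_incl hc]
    refine SetLike.coe_injective (Function.Surjective.range_comp (f := φ) (fun x => ?_)
      (CofreeHopf.incl hc))
    exact ⟨ψ x, congr($h₂ x)⟩
  · refine (congrArg (CofreeHopf.incl hc) (antipode_bialgHom_apply φ x).symm).trans ?_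
    exact CofreeHopf.incl_antipode hc (φ x)

end Description

end HopfAdj

theorem mainTheorem2 (k : Type u) [Field k] :
    -- the two inclusions have left adjoints
    (HopfAdj.hopfToBialg k).IsRightAdjoint ∧
    (HopfAdj.shopfToHopf k).IsRightAdjoint ∧
    -- the products of alternating copies of `B` and `B^{op,cop}` exist
    (∀ B : BialgCat.{u} k, HasProduct (HopfAdj.alternating B)) ∧
    -- the two inclusions have right adjoints, and these are given as follows
    ∃ (Hstar : BialgCat.{u} k ⥤ HopfAlgCat.{u} k) (adjH : HopfAdj.hopfToBialg k ⊣ Hstar)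
      (Kstar : HopfAlgCat.{u} k ⥤ HopfAdj.SHopfAlgCat k) (adjK : HopfAdj.shopfToHopf k ⊣ Kstar),
      -- for every product `P` of the alternating copies, the sum of all subcoalgebras of `P` on
      -- which the shift acts as an antipode is the largest one, and `Hstar B` is this subspace,
      -- with the structure induced from `P`, the shift as antipode and counit given by `π_0`
      (∀ (B : BialgCat.{u} k) (c : Fan (HopfAdj.alternating B)) (hc : IsLimit c),
        IsGreatest (HopfAdj.antipodalSubcoalgebras hc) (HopfAdj.antipodalPart hc) ∧
        ∃ incl : Hstar.obj B →ₐc[k] c.pt,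
          Function.Injective incl ∧
          LinearMap.range (incl : Hstar.obj B →ₗ[k] c.pt) = HopfAdj.antipodalPart hc ∧
          (∀ x : Hstar.obj B, incl (HopfAlgebra.antipode k x) = HopfAdj.shiftLin hc (incl x)) ∧
          (∀ x : Hstar.obj B,
            (c.proj 0).toBialgHom (incl x) = (adjH.counit.app B).toBialgHom x)) ∧
      -- `Kstar H` is the opposite of `Hstar (H^{op})`, compatibly with the counits
      (∀ H : HopfAlgCat.{u} k,
        ∃ (hS : Function.Bijective (HopfAlgebra.antipode k :
              Hstar.obj (HopfAdj.hopfOpBialg H) →ₗ[k] Hstar.obj (HopfAdj.hopfOpBialg H)))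
          (e : HopfAdj.opHopf (Hstar.obj (HopfAdj.hopfOpBialg H)) hS ≅ (Kstar.obj H).obj),
          ∀ x : Hstar.obj (HopfAdj.hopfOpBialg H),
            HopfAdj.opBialgEquiv ((HopfAdj.hopfToBialg k).obj H)
                ((adjK.counit.app H).toBialgHom
                  (e.hom.toBialgHom (HopfAdj.opHopfEquiv _ hS x))) =
              (adjH.counit.app (HopfAdj.hopfOpBialg H)).toBialgHom x) := by
  refine ⟨HopfAdj.isRightAdjoint_hopfToBialg k, HopfAdj.isRightAdjoint_shopfToHopf k,
    fun B => HopfAdj.hasProduct_bialgCat _, _,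
    HopfAdj.adjunctionOfUniversal _ _ _ HopfAdj.bijective_comp_cofreeHopfCounit, _,
    HopfAdj.adjunctionOfUniversal _ _ _ HopfAdj.bijective_comp_cofreeSHopfCounit,
    fun B c hc => ⟨HopfAdj.isGreatest_antipodalPart hc, ?_⟩,
    -- The right adjoint of `i` is by construction the opposite of the cofree Hopf algebra on
    -- `H^{op}`, so the identity serves as the isomorphism.
    fun H => ⟨HopfAdj.bijectiveAntipode_cofreeHopfCat H, Iso.refl _, fun x => ?_⟩⟩
  · rw [HopfAdj.adjunctionOfUniversal_counit_app]
    exact HopfAdj.exists_cofreeHopfCat_incl hc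
  · rw [HopfAdj.adjunctionOfUniversal_counit_app, HopfAdj.adjunctionOfUniversal_counit_app]
    exact (HopfAdj.opBialgEquiv ((HopfAdj.hopfToBialg k).obj H)).apply_symm_apply _
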